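/- Let $n\ge 0$ be an integer, let $t,u,v\in\mathbb C$, and let $W$ be the Weyl group of type $A_{n-1}$, $D_n$ or $B_n$: respectively the symmetric group $S_n$, the group of signed permutations of $1,\dots,n$ with an even number of sign changes, or the group of all signed permutations. It acts diagonally on $\mathfrak h^*=\bigoplus_i\mathbb C x_i$ and $\mathfrak h=\bigoplus_i\mathbb C y_i$ by signed permutations of the coordinates. Let $\mathcal C_{\mathfrak h^*}$ (resp. $\mathcal C_{\mathfrak h}$) be the Clifford algebra generated by $c_1,\dots,c_n$ (resp. $e_1,\dots,e_n$) with $c_i^2=1$ and $c_ic_j=-c_jc_i$ for $i\neq j$ (and likewise for the $e_i$), and write $\mathbb C[\mathfrak h^*]=\mathbb C[x_1,\dots,x_n]$, $\mathbb C[\mathfrak h]=\mathbb C[y_1,\dots,y_n]$. Let $s_{ij}$ be the transposition of $i$ and $j$, $\overline s_{ij}$ the transposition of $i$ and $j$ coupled with the sign changes at $i$ and $j$, and $\tau_i$ the sign change at $i$. Let $\mathbf H_W$ be the unital associative $\mathbb C$-algebra generated by $x_i,y_i,c_i,e_i$ $(1\le i\le n)$ and $W$, subject to the relations of the group algebra $\mathbb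 CW$, the relations of $\mathcal C_{\mathfrak h^*}$ and $\mathcal C_{\mathfrak h}$, and, for all $i,j$ and all $\sigma\in W$, $$c_ie_j=-e_jc_i,\qquad x_ix_j=x_jx_i,\qquad y_iy_j=y_jy_i,$$ $$\sigma z_i=\pm z_{k}\,\sigma\quad\text{for } z\in\{x,y,c,e\},\ \text{where } \sigma \text{ sends the } i\text{-th basis vector to } \pm \text{ the } k\text{-th one},$$ $$e_ix_j=x_je_i,\qquad c_ix_j=(-1)^{\delta_{ij}}x_jc_i,\qquad c_iy_j=y_jc_i,\qquad e_iy_j=(-1)^{\delta_{ij}}y_je_i,$$ together with the following commutators, where $i\ne j$. Type $A_{n-1}$: $$[y_i,x_j]=u(1+c_ic_j)(1+e_je_i)s_{ij},\qquad [y_i,x_i]=tc_ie_i-u\sum_{k\neq i}(1+c_kc_i)(1+e_ke_i)s_{ki}.$$ Type $D_n$: $$[y_i,x_j]=u(1+c_ic_j)(1+e_je_i)s_{ij}-u(1-c_ic_j)(1-e_je_i)\overline s_{ij},$$ $$[y_i,x_i]=tc_ie_i-u\sum_{k\neq i}(1+c_kc_i)(1+e_ke_i)s_{ki}-u\sum_{k\neq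 i}(1-c_kc_i)(1-e_ke_i)\overline s_{ki}.$$ Type $B_n$: the same $[y_i,x_j]$ as in type $D_n$, and $[y_i,x_i]$ as in type $D_n$ with the additional term $-v\tau_i$. Then in each of the three types $\mathbb C[\mathfrak h^*]$, $\mathcal C_{\mathfrak h^*}$, $\mathbb CW$, $\mathbb C[\mathfrak h]$ and $\mathcal C_{\mathfrak h}$ are subalgebras of $\mathbf H_W$ (the canonical maps sending generators to generators are injective), and multiplication induces an isomorphism of vector spaces $$\mathbb C[\mathfrak h^*]\otimes\mathcal C_{\mathfrak h^*}\otimes\mathbb CW\otimes\mathbb C[\mathfrak h]\otimes\mathcal C_{\mathfrak h}\;\xrightarrow{\ \simeq\ }\;\mathbf H_W .$$ Equivalently, the elements $x^\alpha c^{\epsilon}we^{\epsilon'}y^\gamma$ with $\alpha,\gamma\in\mathbb Z_{\ge0}^n$, $\epsilon,\epsilon'\in\{0,1\}^n$ and $w\in W$ form a linear basis of $\mathbf H_W$, where $x^\alpha=x_1^{\alpha_1}\cdots x_n^{\alpha_n}$, $c^\epsilon=c_1^{\epsilon_1}\cdots c_n^{\epsilon_n}$, and similarly for $e^{\epsilon'}$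 and $y^\gamma$. -/

import Mathlib

open scoped TensorProduct

noncomputable section

namespace Daha

/-- The group of signed permutations of `1, …, n` (the Weyl group of type `B_n`), as the semidirect
product of the group of sign vectors and the symmetric group. The element `w = (f, σ)` acts on the
standard basis by `w 𝔢_i = f (σ i) 𝔢_{σ i}`. -/
abbrev SignedPerm (n : ℕ) : Type :=
  (Fin n → ℤˣ) ⋊[mulAutArrow] Equiv.Perm (Fin n)

/-- The sign in `w 𝔢_i = ± 𝔢_{σ i}`, as a complex number. -/
def sgn {n : ℕ} (w : SignedPerm n) (i : Fin n) : ℂ := ((w.left (w.right i) : ℤ) : ℂ)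

/-- The transposition `s_{ij} = (i, j)`. -/
def transp {n : ℕ} (i j : Fin n) : SignedPerm n := SemidirectProduct.inr (Equiv.swap i j)

/-- The sign change `τ_i` at `i`. -/
def signChange {n : ℕ} (i : Fin n) : SignedPerm n := SemidirectProduct.inl (Pi.mulSingle i (-1))

/-- The transposition of `i` and `j` coupled with the sign changes at `i` and `j`
(used for `i ≠ j` only). -/
def transpBar {n : ℕ} (i j : Fin n) : SignedPerm n := signChange i * signChange j * transp i j

/-- The Weyl group of type `D_n`: the signed permutations with an even number of signs. -/
def evenSignedPerm (n : ℕ) : Subgroup (SignedPerm n) where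
  carrier := {w | ∏ i, w.left i = 1}
  one_mem' := by simp
  mul_mem' := by
    intro a b ha hb
    simp only [Set.mem_ofPred_eq, SemidirectProduct.mul_left, Pi.mul_apply,
      Finset.prod_mul_distrib] at ha hb ⊢
    rw [ha, one_mul]
    exact (Equiv.prod_comp (a.right⁻¹ : Equiv.Perm (Fin n)) b.left).trans hb
  inv_mem' := by
    intro a ha
    simp only [Set.mem_ofPred_eq, SemidirectProduct.inv_left] at ha ⊢
    refine (Equiv.prod_comp (a.right⁻¹⁻¹ : Equiv.Perm (Fin n)) (a.left)⁻¹).trans ?_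
    simp [ha]

theorem transp_mem {n : ℕ} (i j : Fin n) : transp i j ∈ evenSignedPerm n := by
  change ∏ k, (transp i j).left k = 1
  simp [transp]

theorem transpBar_mem {n : ℕ} (i j : Fin n) : transpBar i j ∈ evenSignedPerm n := by
  refine mul_mem ?_ (transp_mem i j)
  change ∏ k, (signChange i * signChange j : SignedPerm n).left k = 1
  simp [signChange, ← map_mul, Finset.prod_mul_distrib]

/-- `s_{ij}` as an element of the Weyl group of type `D_n`. -/
def transpD {n : ℕ} (i j : Fin n) : evenSignedPerm n := ⟨transp i j, transp_mem i j⟩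

/-- The barred `s_{ij}` as an element of the Weyl group of type `D_n`. -/
def transpBarD {n : ℕ} (i j : Fin n) : evenSignedPerm n := ⟨transpBar i j, transpBar_mem i j⟩

/-- The generators of the algebra: `x_i`, `y_i`, the Clifford generators `c_i`, `e_i`, and the
elements of the group `W`. -/
inductive Gen (n : ℕ) (W : Type) : Type
  | x (i : Fin n) : Gen n W
  | y (i : Fin n) : Gen n W
  | c (i : Fin n) : Gen n W
  | e (i : Fin n) : Gen n W
  | w (g : W) : Gen n W

/-- The free complex algebra on the generators. -/
abbrev Free (n : ℕ) (W : Type) : Type := FreeAlgebra ℂ (Gen n W)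

section Letters
variable {n : ℕ} {W : Type}

def fx (i : Fin n) : Free n W := FreeAlgebra.ι ℂ (Gen.x i)
def fy (i : Fin n) : Free n W := FreeAlgebra.ι ℂ (Gen.y i)
def fc (i : Fin n) : Free n W := FreeAlgebra.ι ℂ (Gen.c i)
def fe (i : Fin n) : Free n W := FreeAlgebra.ι ℂ (Gen.e i)
def fw (g : W) : Free n W := FreeAlgebra.ι ℂ (Gen.w g)

end Letters

/-- The sign `(-1)^{δ_{ij}}`. -/
def deltaSign {n : ℕ} (i j : Fin n) : ℂ := if i = j then -1 else 1

/-- The defining relations, for a group `W` acting by signed permutations through `ρ`;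
`κ i j` is the prescribed value of the commutator `[y_i, x_j]`. -/
inductive Rel {n : ℕ} {W : Type} [Group W] (ρ : W →* SignedPerm n)
    (κ : Fin n → Fin n → Free n W) : Free n W → Free n W → Prop
  -- the group algebra of `W`
  | w_one : Rel ρ κ (fw 1) 1
  | w_mul (g h : W) : Rel ρ κ (fw g * fw h) (fw (g * h))
  -- the Clifford algebra on the `2 n` generators `c_i`, `e_i`
  | c_sq (i : Fin n) : Rel ρ κ (fc i * fc i) 1
  | e_sq (i : Fin n) : Rel ρ κ (fe i * fe i) 1
  | c_c (i j : Fin n) (h : i ≠ j) : Rel ρ κ (fc i * fc j) (-(fc j * fc i))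
  | e_e (i j : Fin n) (h : i ≠ j) : Rel ρ κ (fe i * fe j) (-(fe j * fe i))
  | c_e (i j : Fin n) : Rel ρ κ (fc i * fe j) (-(fe j * fc i))
  -- the polynomial algebras
  | x_x (i j : Fin n) : Rel ρ κ (fx i * fx j) (fx j * fx i)
  | y_y (i j : Fin n) : Rel ρ κ (fy i * fy j) (fy j * fy i)
  -- the diagonal action of `W`
  | w_c (g : W) (i : Fin n) :
      Rel ρ κ (fw g * fc i) (sgn (ρ g) i • (fc ((ρ g).right i) * fw g))
  | w_e (g : W) (i : Fin n) :
      Rel ρ κ (fw g * fe i) (sgn (ρ g) i • (fe ((ρ g).right i) * fw g))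
  | w_x (g : W) (i : Fin n) :
      Rel ρ κ (fw g * fx i) (sgn (ρ g) i • (fx ((ρ g).right i) * fw g))
  | w_y (g : W) (i : Fin n) :
      Rel ρ κ (fw g * fy i) (sgn (ρ g) i • (fy ((ρ g).right i) * fw g))
  -- Clifford generators against polynomial generators
  | e_x (i j : Fin n) : Rel ρ κ (fe i * fx j) (fx j * fe i)
  | c_x (i j : Fin n) : Rel ρ κ (fc i * fx j) (deltaSign i j • (fx j * fc i))
  | c_y (i j : Fin n) : Rel ρ κ (fc i * fy j) (fy j * fc i)
  | e_y (i j : Fin n) : Rel ρ κ (fe i * fy j) (deltaSign i j • (fy j * fe i))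
  -- the commutators `[y_i, x_j]`
  | y_x (i j : Fin n) : Rel ρ κ (fy i * fx j - fx j * fy i) (κ i j)

/-- The algebra generated by `x_i`, `y_i`, `c_i`, `e_i` and `W` subject to the relations `Rel`. -/
abbrev Alg {n : ℕ} {W : Type} [Group W] (ρ : W →* SignedPerm n)
    (κ : Fin n → Fin n → Free n W) : Type :=
  RingQuot (Rel ρ κ)

/-- The commutators `[y_i, x_j]` in type `A_{n-1}`, where `W` is the symmetric group. The double affine
Hecke algebra of this type is `Alg (inclA n) (kappaA n t u)`. -/
def kappaA (n : ℕ) (t u : ℂ) (i j : Fin n) : Free n (Equiv.Perm (Fin n)) :=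
  if i = j then
    t • (fc i * fe i)
      - u • ∑ k ∈ Finset.univ.erase i,
          (1 + fc k * fc i) * (1 + fe k * fe i) * fw (Equiv.swap k i)
  else
    u • ((1 + fc i * fc j) * (1 + fe j * fe i) * fw (Equiv.swap i j))

/-- The commutators `[y_i, x_j]` in type `D_n`. The double affine Hecke algebra of this type is
`Alg (evenSignedPerm n).subtype (kappaD n t u)`. -/
def kappaD (n : ℕ) (t u : ℂ) (i j : Fin n) : Free n (evenSignedPerm n) :=
  if i = j then
    t • (fc i * fe i)
      - u • ∑ k ∈ Finset.univ.erase i,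
          (1 + fc k * fc i) * (1 + fe k * fe i) * fw (transpD k i)
      - u • ∑ k ∈ Finset.univ.erase i,
          (1 - fc k * fc i) * (1 - fe k * fe i) * fw (transpBarD k i)
  else
    u • ((1 + fc i * fc j) * (1 + fe j * fe i) * fw (transpD i j))
      - u • ((1 - fc i * fc j) * (1 - fe j * fe i) * fw (transpBarD i j))

/-- The commutators `[y_i, x_j]` in type `B_n`. The double affine Hecke algebra of this type is
`Alg (MonoidHom.id (SignedPerm n)) (kappaB n t u v)`. -/
def kappaB (n : ℕ) (t u v : ℂ) (i j : Fin n) : Free n (SignedPerm n) :=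
  if i = j then
    t • (fc i * fe i)
      - u • ∑ k ∈ Finset.univ.erase i,
          (1 + fc k * fc i) * (1 + fe k * fe i) * fw (transp k i)
      - u • ∑ k ∈ Finset.univ.erase i,
          (1 - fc k * fc i) * (1 - fe k * fe i) * fw (transpBar k i)
      - v • fw (signChange i)
  else
    u • ((1 + fc i * fc j) * (1 + fe j * fe i) * fw (transp i j))
      - u • ((1 - fc i * fc j) * (1 - fe j * fe i) * fw (transpBar i j))

/-- The inclusion of the symmetric group into the signed permutations. -/
def inclA (n : ℕ) : Equiv.Perm (Fin n) →* SignedPerm n := SemidirectProduct.inr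

section PBW
variable {n : ℕ} {W : Type} [Group W] (ρ : W →* SignedPerm n) (κ : Fin n → Fin n → Free n W)

/-- The quotient map from the free algebra. -/
def proj : Free n W →ₐ[ℂ] Alg ρ κ := RingQuot.mkAlgHom ℂ (Rel ρ κ)

def x (i : Fin n) : Alg ρ κ := proj ρ κ (fx i)
def y (i : Fin n) : Alg ρ κ := proj ρ κ (fy i)
def c (i : Fin n) : Alg ρ κ := proj ρ κ (fc i)
def e (i : Fin n) : Alg ρ κ := proj ρ κ (fe i)
def w (g : W) : Alg ρ κ := proj ρ κ (fw g)

/-- The ordered monomial `a_1^{m_1} ⋯ a_n^{m_n}`. -/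
def orderedMonomial {A : Type} [Monoid A] (a : Fin n → A) (m : Fin n → ℕ) : A :=
  (List.ofFn fun i => a i ^ m i).prod

/-- The element `x^α c^ε w e^{ε'} y^γ` attached to `(α, ε, w, ε', γ)`. -/
def pbwMonomial
    (p : (Fin n → ℕ) × (Fin n → ZMod 2) × W × (Fin n → ZMod 2) × (Fin n → ℕ)) : Alg ρ κ :=
  orderedMonomial (x ρ κ) p.1
    * orderedMonomial (c ρ κ) (fun i => (p.2.1 i).val)
    * w ρ κ p.2.2.1
    * orderedMonomial (e ρ κ) (fun i => (p.2.2.2.1 i).val)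
    * orderedMonomial (y ρ κ) p.2.2.2.2

/-- The PBW monomials, indexed by `(α, ε, w, ε', γ)`, form a linear basis. -/
def IsPBWBasis : Prop :=
  LinearIndependent ℂ (pbwMonomial ρ κ) ∧ Submodule.span ℂ (Set.range (pbwMonomial ρ κ)) = ⊤

/-- The Clifford algebra of `ℂ^n` with the form `∑ v_i ^ 2`: its generators, the images of the
standard basis vectors, square to `1` and pairwise anticommute. -/
abbrev Cliff (n : ℕ) : Type :=
  CliffordAlgebra (QuadraticMap.weightedSumSquares ℂ (fun _ : Fin n => (1 : ℂ)))

/-- The generators of the Clifford algebra. -/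
def Cliff.gen (i : Fin n) : Cliff n :=
  CliffordAlgebra.ι (QuadraticMap.weightedSumSquares ℂ (fun _ : Fin n => (1 : ℂ))) (Pi.single i 1)

/-- The linear map `a ⊗ b ⊗ g ⊗ d ⊗ f ↦ a b g d f` defined by five algebra maps. -/
def mulMap {A₁ A₂ A₃ A₄ A₅ H : Type} [Ring A₁] [Ring A₂] [Ring A₃] [Ring A₄] [Ring A₅] [Ring H]
    [Algebra ℂ A₁] [Algebra ℂ A₂] [Algebra ℂ A₃] [Algebra ℂ A₄] [Algebra ℂ A₅] [Algebra ℂ H]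
    (φ₁ : A₁ →ₐ[ℂ] H) (φ₂ : A₂ →ₐ[ℂ] H) (φ₃ : A₃ →ₐ[ℂ] H) (φ₄ : A₄ →ₐ[ℂ] H) (φ₅ : A₅ →ₐ[ℂ] H) :
    A₁ ⊗[ℂ] (A₂ ⊗[ℂ] (A₃ ⊗[ℂ] (A₄ ⊗[ℂ] A₅))) →ₗ[ℂ] H :=
  LinearMap.mul' ℂ H ∘ₗ TensorProduct.map φ₁.toLinearMap
    (LinearMap.mul' ℂ H ∘ₗ TensorProduct.map φ₂.toLinearMap
      (LinearMap.mul' ℂ H ∘ₗ TensorProduct.map φ₃.toLinearMap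
        (LinearMap.mul' ℂ H ∘ₗ TensorProduct.map φ₄.toLinearMap φ₅.toLinearMap)))

/-- The polynomial algebras on the `x_i` and on the `y_i`, the Clifford algebras on the `c_i` and on
the `e_i`, and the group algebra of `W` are subalgebras (the embeddings are determined by the values
on generators), and multiplication induces a linear isomorphism
`ℂ[x] ⊗ Cliff(c) ⊗ ℂ W ⊗ ℂ[y] ⊗ Cliff(e) ≅ Alg`. -/
def IsPBWIso : Prop :=
  ∃ (φx : MvPolynomial (Fin n) ℂ →ₐ[ℂ] Alg ρ κ) (φc : Cliff n →ₐ[ℂ] Alg ρ κ)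
    (φw : MonoidAlgebra ℂ W →ₐ[ℂ] Alg ρ κ)
    (φy : MvPolynomial (Fin n) ℂ →ₐ[ℂ] Alg ρ κ) (φe : Cliff n →ₐ[ℂ] Alg ρ κ),
    (∀ i, φx (MvPolynomial.X i) = x ρ κ i) ∧ (∀ i, φc (Cliff.gen i) = c ρ κ i) ∧
    (∀ g, φw (MonoidAlgebra.of ℂ W g) = w ρ κ g) ∧
    (∀ i, φy (MvPolynomial.X i) = y ρ κ i) ∧ (∀ i, φe (Cliff.gen i) = e ρ κ i) ∧
    Function.Injective φx ∧ Function.Injective φc ∧ Function.Injective φw ∧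
    Function.Injective φy ∧ Function.Injective φe ∧
    Function.Bijective (mulMap φx φc φw φy φe)

end PBW

end Daha

end

/-! The monomials span because the relations move every $y_i$ to the right. For independence, the
algebra is represented faithfully enough on the space that it ought to be: the free left module
`PBWModule` with basis the $y^\gamma$ over the positive part `PosAlg`, the algebra presented by the
$x_i, c_i, e_i$ and $W$ alone.

The positive part has the basis $x^\alpha c^\epsilon w e^{\epsilon'}$. It is spanned by these
monomials by reordering (`span_posMonomial`). They are independent because explicit signed shift
operators on $W\times$ exponents satisfy the relations and send one vector to distinct basis
vectors, up to units (`linearIndependent_posMonomial`).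

The action of $y_i$ on $p\,y^\gamma$ should be found by commuting $y_i$ past $p$. To make this well
defined without choosing a basis of the positive part, that part is made to act on columns $((y_i
m)_i, m)$ by block-triangular operators; they satisfy its relations (`ext_rep`) as soon as the
commutators $k_{ij}=[y_i,x_j]$ satisfy the conditions `Good`. These are equivariance under $c$, $e$,
$W$ and the two Jacobi identities, for $(y,x,x)$ and $(y,y,x)$. The second one gives $y_iy_j=y_jy_i$
on the module (`yAct_comm`). The evident map from the module to the algebra is then equivariant,
which gives spanning, and acting on $y^0$ gives independence.

It remains to verify `Good` in each type. The conditions are linear in $k$, so the $t$, $u$, $v$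
parts are separate. The $u$ part is a sum over reflections with sign $\eta=\pm1$. For it, the Jacobi
identities reduce to one exchange of a diagonal and an off-diagonal summand
(`Base.diagTerm_x_offTerm`), and the symmetry $(x,c)\leftrightarrow(y,e)$ halves the work. -/

noncomputable section

namespace Daha

/-! ### Evaluation of noncommutative polynomials -/

section Evaluation
variable {n : ℕ} {W : Type} {B B' : Type} [Ring B] [Algebra ℂ B] [Ring B'] [Algebra ℂ B']

/-- The values of the generators under an evaluation. -/
def genMap (x y c e : Fin n → B) (w : W → B) : Gen n W → B
  | .x i => x i
  | .y i => y i
  | .c i => c i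
  | .e i => e i
  | .w g => w g

/-- The evaluation of noncommutative polynomials at elements of an algebra. -/
def eval (x y c e : Fin n → B) (w : W → B) : Free n W →ₐ[ℂ] B :=
  FreeAlgebra.lift ℂ (genMap x y c e w)

variable (x y c e : Fin n → B) (w : W → B)

@[simp] theorem eval_fx (i : Fin n) : eval x y c e w (fx i) = x i := by simp [eval, fx, genMap]
@[simp] theorem eval_fy (i : Fin n) : eval x y c e w (fy i) = y i := by simp [eval, fy, genMap]
@[simp] theorem eval_fc (i : Fin n) : eval x y c e w (fc i) = c i := by simp [eval, fc, genMap]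
@[simp] theorem eval_fe (i : Fin n) : eval x y c e w (fe i) = e i := by simp [eval, fe, genMap]
@[simp] theorem eval_fw (g : W) : eval x y c e w (fw g) = w g := by simp [eval, fw, genMap]

theorem map_eval (f : B →ₐ[ℂ] B') (a : Free n W) :
    f (eval x y c e w a) =
      eval (fun i => f (x i)) (fun i => f (y i)) (fun i => f (c i)) (fun i => f (e i))
        (fun g => f (w g)) a := by
  have : f.comp (eval x y c e w) = eval (fun i => f (x i)) (fun i => f (y i)) (fun i => f (c i))
      (fun i => f (e i)) (fun g => f (w g)) := by
    refine FreeAlgebra.hom_ext (funext fun g => ?_)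
    cases g <;> simp [eval, genMap]
  exact DFunLike.congr_fun this a

theorem eval_comp (f : Free n W →ₐ[ℂ] B) :
    eval (fun i => f (fx i)) (fun i => f (fy i)) (fun i => f (fc i)) (fun i => f (fe i))
      (fun g => f (fw g)) = f := by
  refine FreeAlgebra.hom_ext (funext fun g => ?_)
  cases g <;> simp [eval, genMap, fx, fy, fc, fe, fw]

end Evaluation

theorem sgn_eq_one_or {n : ℕ} (g : SignedPerm n) (i : Fin n) : sgn g i = 1 ∨ sgn g i = -1 := by
  rcases Int.units_eq_one_or (g.left (g.right i)) with h | h <;> simp [sgn, h]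

theorem sgn_mul_self {n : ℕ} (g : SignedPerm n) (i : Fin n) : sgn g i * sgn g i = 1 := by
  rcases sgn_eq_one_or g i with h | h <;> simp [h]

theorem sgn_mul {n : ℕ} (g h : SignedPerm n) (i : Fin n) :
    sgn (g * h) i = sgn g (h.right i) * sgn h i := by
  simp only [sgn, SemidirectProduct.mul_left, SemidirectProduct.mul_right]
  have : (mulAutArrow g.right h.left) ((g.right * h.right) i) = h.left (h.right i) := by
    change h.left (g.right⁻¹ • ((g.right * h.right) i)) = _
    simp
  rw [Pi.mul_apply, this]
  push_cast
  rfl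

theorem deltaSign_eq_one_or {n : ℕ} (i j : Fin n) : deltaSign i j = 1 ∨ deltaSign i j = -1 := by
  unfold deltaSign; split_ifs <;> simp

@[simp] theorem deltaSign_self {n : ℕ} (i : Fin n) : deltaSign i i = -1 := by simp [deltaSign]

theorem deltaSign_of_ne {n : ℕ} {i j : Fin n} (h : i ≠ j) : deltaSign i j = 1 := by
  simp [deltaSign, h]

theorem deltaSign_mul_self {n : ℕ} (i j : Fin n) : deltaSign i j * deltaSign i j = 1 := by
  rcases deltaSign_eq_one_or i j with h | h <;> simp [h]

/-! ### The relations in an arbitrary algebra, and consistency conditions on commutators -/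

section Relations
variable {n : ℕ} {W : Type} [Group W] {B : Type} [Ring B] [Algebra ℂ B]

/-- The defining relations that do not involve two polynomial generators. -/
structure Base (ρ : W →* SignedPerm n) (x y c e : Fin n → B) (w : W → B) : Prop where
  w_one : w 1 = 1
  w_mul (g h : W) : w g * w h = w (g * h)
  c_sq (i : Fin n) : c i * c i = 1
  e_sq (i : Fin n) : e i * e i = 1
  c_c (i j : Fin n) (h : i ≠ j) : c i * c j = -(c j * c i)
  e_e (i j : Fin n) (h : i ≠ j) : e i * e j = -(e j * e i)
  c_e (i j : Fin n) : c i * e j = -(e j * c i)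
  w_c (g : W) (i : Fin n) : w g * c i = sgn (ρ g) i • (c ((ρ g).right i) * w g)
  w_e (g : W) (i : Fin n) : w g * e i = sgn (ρ g) i • (e ((ρ g).right i) * w g)
  w_x (g : W) (i : Fin n) : w g * x i = sgn (ρ g) i • (x ((ρ g).right i) * w g)
  w_y (g : W) (i : Fin n) : w g * y i = sgn (ρ g) i • (y ((ρ g).right i) * w g)
  e_x (i j : Fin n) : e i * x j = x j * e i
  c_x (i j : Fin n) : c i * x j = deltaSign i j • (x j * c i)
  c_y (i j : Fin n) : c i * y j = y j * c i
  e_y (i j : Fin n) : e i * y j = deltaSign i j • (y j * e i)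

/-- The exchange $(x,c)\leftrightarrow(y,e)$ preserves these relations; every statement about $x$
and $c$ below thereby also yields one about $y$ and $e$. -/
theorem Base.symm {ρ : W →* SignedPerm n} {x y c e : Fin n → B} {w : W → B}
    (h : Base ρ x y c e w) : Base ρ y x e c w where
  w_one := h.w_one
  w_mul := h.w_mul
  c_sq := h.e_sq
  e_sq := h.c_sq
  c_c := h.e_e
  e_e := h.c_c
  c_e i j := by rw [h.c_e, neg_neg]
  w_c := h.w_e
  w_e := h.w_c
  w_x := h.w_y
  w_y := h.w_x
  e_x := h.c_y
  c_x := h.e_y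
  c_y := h.e_x
  e_y := h.c_x

/-- All the defining relations, with `k i j` the value of `[y_i, x_j]`. -/
structure Rep (ρ : W →* SignedPerm n) (k : Fin n → Fin n → B) (x y c e : Fin n → B) (w : W → B) :
    Prop extends Base ρ x y c e w where
  x_x (i j : Fin n) : x i * x j = x j * x i
  y_y (i j : Fin n) : y i * y j = y j * y i
  y_x (i j : Fin n) : y i * x j - x j * y i = k i j

theorem Rep.eval_eq {ρ : W →* SignedPerm n} {κ : Fin n → Fin n → Free n W}
    {x y c e : Fin n → B} {w : W → B} (h : Rep ρ (fun i j => eval x y c e w (κ i j)) x y c e w)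
    ⦃a b : Free n W⦄ (hab : Rel ρ κ a b) : eval x y c e w a = eval x y c e w b := by
  cases hab with
  | w_one => simpa using h.w_one
  | w_mul g g' => simpa using h.w_mul g g'
  | c_sq i => simpa using h.c_sq i
  | e_sq i => simpa using h.e_sq i
  | c_c i j hij => simpa using h.c_c i j hij
  | e_e i j hij => simpa using h.e_e i j hij
  | c_e i j => simpa using h.c_e i j
  | x_x i j => simpa using h.x_x i j
  | y_y i j => simpa using h.y_y i j
  | w_c g i => simpa using h.w_c g i
  | w_e g i => simpa using h.w_e g i
  | w_x g i => simpa using h.w_x g i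
  | w_y g i => simpa using h.w_y g i
  | e_x i j => simpa using h.e_x i j
  | c_x i j => simpa using h.c_x i j
  | c_y i j => simpa using h.c_y i j
  | e_y i j => simpa using h.e_y i j
  | y_x i j => simpa using h.y_x i j

/-- An algebra map that respects the relations makes the images of the generators satisfy them. -/
theorem Rep.of_map {ρ : W →* SignedPerm n} {κ : Fin n → Fin n → Free n W}
    (f : Free n W →ₐ[ℂ] B) (hf : ∀ a b, Rel ρ κ a b → f a = f b) :
    Rep ρ (fun i j => f (κ i j)) (fun i => f (fx i)) (fun i => f (fy i)) (fun i => f (fc i))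
      (fun i => f (fe i)) (fun g => f (fw g)) where
  w_one := by simpa using hf _ _ .w_one
  w_mul g g' := by simpa using hf _ _ (.w_mul g g')
  c_sq i := by simpa using hf _ _ (.c_sq i)
  e_sq i := by simpa using hf _ _ (.e_sq i)
  c_c i j hij := by simpa using hf _ _ (.c_c i j hij)
  e_e i j hij := by simpa using hf _ _ (.e_e i j hij)
  c_e i j := by simpa using hf _ _ (.c_e i j)
  x_x i j := by simpa using hf _ _ (.x_x i j)
  y_y i j := by simpa using hf _ _ (.y_y i j)
  w_c g i := by simpa using hf _ _ (.w_c g i)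
  w_e g i := by simpa using hf _ _ (.w_e g i)
  w_x g i := by simpa using hf _ _ (.w_x g i)
  w_y g i := by simpa using hf _ _ (.w_y g i)
  e_x i j := by simpa using hf _ _ (.e_x i j)
  c_x i j := by simpa using hf _ _ (.c_x i j)
  c_y i j := by simpa using hf _ _ (.c_y i j)
  e_y i j := by simpa using hf _ _ (.e_y i j)
  y_x i j := by simpa using hf _ _ (.y_x i j)

/-- The conditions on the commutators `k i j = [y_i, x_j]` under which the relations are
consistent. -/
structure Good (ρ : W →* SignedPerm n) (x y c e : Fin n → B) (w : W → B)
    (k : Fin n → Fin n → B) : Prop where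
  c_k (l i j : Fin n) : c l * k i j = deltaSign l j • (k i j * c l)
  e_k (l i j : Fin n) : e l * k i j = deltaSign l i • (k i j * e l)
  w_k (g : W) (i j : Fin n) : w g * k i j =
    (sgn (ρ g) i * sgn (ρ g) j) • (k ((ρ g).right i) ((ρ g).right j) * w g)
  k_x (i j l : Fin n) : k i j * x l - x l * k i j = k i l * x j - x j * k i l
  y_k (i j l : Fin n) : y i * k j l - k j l * y i = y j * k i l - k i l * y j

namespace Good
variable {ρ : W →* SignedPerm n} {x y c e : Fin n → B} {w : W → B} {k k' : Fin n → Fin n → B}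

/-- The conditions are linear in $k$, so the contributions of $t$, $u$ and $v$ can be verified one
at a time. -/
theorem add (h : Good ρ x y c e w k) (h' : Good ρ x y c e w k') :
    Good ρ x y c e w (k + k') where
  c_k l i j := by simp [mul_add, add_mul, h.c_k, h'.c_k]
  e_k l i j := by simp [mul_add, add_mul, h.e_k, h'.e_k]
  w_k g i j := by simp [mul_add, add_mul, h.w_k, h'.w_k]
  k_x i j l := by
    simp only [Pi.add_apply, mul_add, add_mul, add_sub_add_comm, h.k_x i j, h'.k_x i j]
  y_k i j l := by
    simp only [Pi.add_apply, mul_add, add_mul, add_sub_add_comm, h.y_k i j, h'.y_k i j]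

theorem smul (h : Good ρ x y c e w k) (a : ℂ) : Good ρ x y c e w (a • k) where
  c_k l i j := by simp [h.c_k, smul_comm a]
  e_k l i j := by simp [h.e_k, smul_comm a]
  w_k g i j := by simp [h.w_k, smul_comm a]
  k_x i j l := by
    simp only [Pi.smul_apply, mul_smul_comm, smul_mul_assoc, ← smul_sub, h.k_x i j]
  y_k i j l := by
    simp only [Pi.smul_apply, mul_smul_comm, smul_mul_assoc, ← smul_sub, h.y_k i j]

end Good

end Relations

/-! ### The contribution of a single reflection, and the assembly of the commutators -/

section Local
variable {n : ℕ} {W : Type} [Group W] {B : Type} [Ring B] [Algebra ℂ B]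

/-- The element `1 + η c_i c_j`. -/
def cliffPair (η : ℂ) (c : Fin n → B) (i j : Fin n) : B := 1 + η • (c i * c j)

/-- The summands of the diagonal commutators. -/
def diagTerm (η : ℂ) (c e : Fin n → B) (S : Fin n → Fin n → B) (i j : Fin n) : B :=
  cliffPair η c i j * cliffPair η e i j * S i j

/-- The summands of the off-diagonal commutators. -/
def offTerm (η : ℂ) (c e : Fin n → B) (S : Fin n → Fin n → B) (i j : Fin n) : B :=
  η • (cliffPair η c i j * cliffPair η e j i * S i j)

/-- `S i j` exchanges `z_i` and `z_j` up to the sign `η` and commutes with the other `z_l`. -/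
structure SwapsWith (η : ℂ) (S : Fin n → Fin n → B) (z : Fin n → B) : Prop where
  left (i j : Fin n) (h : i ≠ j) : S i j * z i = η • (z j * S i j)
  right (i j : Fin n) (h : i ≠ j) : S i j * z j = η • (z i * S i j)
  other (i j l : Fin n) (h : i ≠ j) (hi : l ≠ i) (hj : l ≠ j) : S i j * z l = z l * S i j

set_option linter.unusedSectionVars false

variable {ρ : W →* SignedPerm n} {x y c e : Fin n → B} {w : W → B} {η : ℂ}
  {S : Fin n → Fin n → B}

/-- Only even products of the $e_i$ occur, so the two signs cancel. -/
theorem cliffPair_commute_of_anticomm (he : ∀ i j, c i * e j = -(e j * c i)) (l i j : Fin n) :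
    c l * cliffPair η e i j = cliffPair η e i j * c l := by
  have : c l * (e i * e j) = e i * e j * c l := by
    rw [← mul_assoc, he, neg_mul, mul_assoc, he, mul_neg, neg_neg, mul_assoc]
  simp only [cliffPair, mul_add, add_mul, mul_one, one_mul, mul_smul_comm, smul_mul_assoc, this]

theorem cliffPair_commute_of_commute (he : ∀ i j, c i * x j = x j * c i) (l i j : Fin n) :
    cliffPair η c i j * x l = x l * cliffPair η c i j := by
  have : c i * c j * x l = x l * (c i * c j) := by
    rw [mul_assoc, he, ← mul_assoc, he, mul_assoc]
  simp only [cliffPair, mul_add, add_mul, mul_one, one_mul, mul_smul_comm, smul_mul_assoc, this]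

theorem Base.cliffPair_comm (h : Base ρ x y c e w) (i j k l : Fin n) :
    cliffPair η c i j * cliffPair η e k l = cliffPair η e k l * cliffPair η c i j := by
  have h1 := cliffPair_commute_of_anticomm (η := η) h.c_e
  have : c i * c j * cliffPair η e k l = cliffPair η e k l * (c i * c j) := by
    rw [mul_assoc, h1, ← mul_assoc, h1, mul_assoc]
  have h2 : cliffPair η c i j = 1 + η • (c i * c j) := rfl
  rw [h2, add_mul, mul_add, smul_mul_assoc, mul_smul_comm, this, one_mul, mul_one]

/-- The element `(1 + η c_i c_j) V S_{ij}` commutes with the `c_l` up to a sign if `V` does so. -/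
theorem clifford_mul_pair (hη : η * η = 1) (hsq : ∀ i, c i * c i = 1)
    (hc : ∀ i j, i ≠ j → c i * c j = -(c j * c i)) {i j : Fin n} (hij : i ≠ j) {V : B}
    (hV : ∀ l, c l * V = V * c l) (hS : SwapsWith η S c) (l : Fin n) :
    c l * (cliffPair η c i j * V * S i j) =
      deltaSign l j • (cliffPair η c i j * V * S i j * c l) := by
  have hji : c j * c i = -(c i * c j) := hc j i hij.symm
  -- It suffices to move $c_l$ past $1+\eta c_ic_j$, where it may come out as another $c_m$; then
  -- $V$ lets it through, and $S_{ij}$ turns $c_m$ back into $\pm c_l$.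
  have key : ∀ (m : Fin n) (s : ℂ), c l * cliffPair η c i j = s • (cliffPair η c i j * c m) →
      c l * (cliffPair η c i j * V * S i j) = s • (cliffPair η c i j * V * (c m * S i j)) := by
    intro m s hs
    rw [← mul_assoc, ← mul_assoc, hs, smul_mul_assoc, smul_mul_assoc, mul_assoc _ (c m), hV]
    simp only [mul_assoc]
  by_cases hli : l = i
  · subst hli
    -- Both sides equal $c_l+\eta c_j$, by $\eta^2=1$ and $c^2=1$.
    have h1 : c l * cliffPair η c l j = η • (cliffPair η c l j * c j) := by
      simp only [cliffPair, mul_add, add_mul, mul_one, one_mul, mul_smul_comm, smul_mul_assoc,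
        smul_add, smul_smul, hη, mul_assoc, hsq, one_smul]
      rw [← mul_assoc, hsq, one_mul, add_comm]
    rw [key _ _ h1, mul_assoc _ (S l j), hS.left l j hij, deltaSign_of_ne hij, one_smul,
      mul_smul_comm]
  by_cases hlj : l = j
  · subst hlj
    -- Both sides equal $c_l-\eta c_i$; the extra minus sign compared with the case $l=i$ is the
    -- source of $(-1)^{\delta_{lj}}$.
    have h1 : c l * cliffPair η c i l = (-η) • (cliffPair η c i l * c i) := by
      simp only [cliffPair, mul_add, add_mul, mul_one, one_mul, mul_smul_comm, smul_mul_assoc,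
        smul_add, smul_smul, neg_mul, hη, mul_assoc, hji]
      rw [← mul_assoc, hji]
      simp [mul_assoc, hsq]
      rw [← mul_assoc, hsq, one_mul, add_comm]
    rw [key _ _ h1, mul_assoc _ (S i l), hS.right i l hij, deltaSign_self, mul_smul_comm, smul_smul,
      neg_one_mul]
  · have h1 : c l * cliffPair η c i j = (1 : ℂ) • (cliffPair η c i j * c l) := by
      have : c l * (c i * c j) = c i * c j * c l := by
        rw [← mul_assoc, hc l i hli, neg_mul, mul_assoc, hc l j hlj, mul_neg, neg_neg, mul_assoc]
      simp only [cliffPair, mul_add, add_mul, mul_one, one_mul, mul_smul_comm, smul_mul_assoc,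
        one_smul, this]
    rw [key _ _ h1, mul_assoc _ (S i j), hS.other i j l hij hli hlj, deltaSign_of_ne hlj]

/-- The conditions on the summands of the commutators that do not involve the group. -/
structure PairGood (x y c e : Fin n → B) (F G : Fin n → Fin n → B) : Prop where
  c_F (i j : Fin n) (h : i ≠ j) (l : Fin n) : c l * F i j = deltaSign l j • (F i j * c l)
  e_F (i j : Fin n) (h : i ≠ j) (l : Fin n) : e l * F i j = deltaSign l j • (F i j * e l)
  c_G (i j : Fin n) (h : i ≠ j) (l : Fin n) : c l * G i j = deltaSign l j • (G i j * c l)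
  e_G (i j : Fin n) (h : i ≠ j) (l : Fin n) : e l * G i j = deltaSign l i • (G i j * e l)
  x_F (i j l : Fin n) (h : i ≠ j) (hi : l ≠ i) (hj : l ≠ j) : F i j * x l = x l * F i j
  x_G (i j l : Fin n) (h : i ≠ j) (hi : l ≠ i) (hj : l ≠ j) : G i j * x l = x l * G i j
  y_F (i j l : Fin n) (h : i ≠ j) (hi : l ≠ i) (hj : l ≠ j) : F i j * y l = y l * F i j
  y_G (i j l : Fin n) (h : i ≠ j) (hi : l ≠ i) (hj : l ≠ j) : G i j * y l = y l * G i j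
  F_x_G (i j : Fin n) (h : i ≠ j) :
    -(F j i * x j - x j * F j i) = G i j * x i - x i * G i j
  F_y_G (i j : Fin n) (h : i ≠ j) :
    -(y i * F i j - F i j * y i) = y j * G i j - G i j * y j

theorem PairGood.add {F G F' G' : Fin n → Fin n → B} (h : PairGood x y c e F G)
    (h' : PairGood x y c e F' G') : PairGood x y c e (F + F') (G + G') where
  c_F i j hij l := by simp [mul_add, add_mul, h.c_F i j hij, h'.c_F i j hij]
  e_F i j hij l := by simp [mul_add, add_mul, h.e_F i j hij, h'.e_F i j hij]
  c_G i j hij l := by simp [mul_add, add_mul, h.c_G i j hij, h'.c_G i j hij]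
  e_G i j hij l := by simp [mul_add, add_mul, h.e_G i j hij, h'.e_G i j hij]
  x_F i j l hij hi hj := by simp [mul_add, add_mul, h.x_F i j l hij hi hj, h'.x_F i j l hij hi hj]
  x_G i j l hij hi hj := by simp [mul_add, add_mul, h.x_G i j l hij hi hj, h'.x_G i j l hij hi hj]
  y_F i j l hij hi hj := by simp [mul_add, add_mul, h.y_F i j l hij hi hj, h'.y_F i j l hij hi hj]
  y_G i j l hij hi hj := by simp [mul_add, add_mul, h.y_G i j l hij hi hj, h'.y_G i j l hij hi hj]
  F_x_G i j hij := by
    simp only [Pi.add_apply, mul_add, add_mul, add_sub_add_comm, neg_add, h.F_x_G i j hij,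
      h'.F_x_G i j hij]
  F_y_G i j hij := by
    simp only [Pi.add_apply, mul_add, add_mul, add_sub_add_comm, neg_add, h.F_y_G i j hij,
      h'.F_y_G i j hij]

/-- Passing $x_i$ or $x_j$ through $c_ic_j$ costs exactly one sign, which is absorbed by reversing
the pair to $c_jc_i$. -/
theorem cliffPair_mul_twisted (hcx : ∀ i j, c i * x j = deltaSign i j • (x j * c i))
    (hc : ∀ i j, i ≠ j → c i * c j = -(c j * c i)) {i j : Fin n} (hij : i ≠ j) :
    cliffPair η c i j * x i = x i * cliffPair η c j i ∧
    cliffPair η c i j * x j = x j * cliffPair η c j i ∧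
    ∀ l, l ≠ i → l ≠ j → cliffPair η c i j * x l = x l * cliffPair η c i j := by
  refine ⟨?_, ?_, fun l hi hj => ?_⟩
  · have : c i * c j * x i = x i * (c j * c i) := by
      rw [mul_assoc, hcx, deltaSign_of_ne hij.symm, one_smul, ← mul_assoc, hcx, deltaSign_self,
        hc j i hij.symm]
      simp [mul_assoc]
    simp only [cliffPair, mul_add, add_mul, mul_one, one_mul, mul_smul_comm, smul_mul_assoc, this]
  · have : c i * c j * x j = x j * (c j * c i) := by
      rw [mul_assoc, hcx, deltaSign_self, mul_smul_comm, ← mul_assoc, hcx, deltaSign_of_ne hij,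
        hc j i hij.symm]
      simp [mul_assoc]
    simp only [cliffPair, mul_add, add_mul, mul_one, one_mul, mul_smul_comm, smul_mul_assoc, this]
  · have : c i * c j * x l = x l * (c i * c j) := by
      rw [mul_assoc, hcx, deltaSign_of_ne hj.symm, one_smul, ← mul_assoc, hcx,
        deltaSign_of_ne hi.symm, one_smul, mul_assoc]
    simp only [cliffPair, mul_add, add_mul, mul_one, one_mul, mul_smul_comm, smul_mul_assoc, this]

section Terms
variable (h : Base ρ x y c e w) (hη : η * η = 1) (hS : ∀ i j, S i j = S j i)
include h

/-- Together with `Base.offTerm_symm` this says how the summands behave under `Base.symm`: the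
diagonal ones are fixed and the off-diagonal ones are transposed. -/
theorem Base.diagTerm_symm (i j : Fin n) : diagTerm η e c S i j = diagTerm η c e S i j := by
  rw [diagTerm, diagTerm, h.cliffPair_comm]

include hS in
theorem Base.offTerm_symm (i j : Fin n) : offTerm η e c S j i = offTerm η c e S i j := by
  rw [offTerm, offTerm, h.cliffPair_comm, hS]

theorem Base.pair_mul_x_of_ne (hSx : SwapsWith η S x) {i j l : Fin n} (hij : i ≠ j) (hi : l ≠ i)
    (hj : l ≠ j) (k k' : Fin n) :
    cliffPair η c i j * cliffPair η e k k' * S i j * x l =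
      x l * (cliffPair η c i j * cliffPair η e k k' * S i j) := by
  rw [mul_assoc _ (S i j), hSx.other i j l hij hi hj, mul_assoc (cliffPair η c i j),
    ← mul_assoc (cliffPair η e k k') (x l), cliffPair_commute_of_commute h.e_x, mul_assoc (x l),
    ← mul_assoc (cliffPair η c i j) (x l), (cliffPair_mul_twisted h.c_x h.c_c hij).2.2 l hi hj]
  simp only [mul_assoc]

include hη hS in
-- Write $F$ and $G$ for the diagonal and off-diagonal terms. Moving $x_j$ to the left through
-- $S_{ji}$ gives $\eta x_i$, and passing the $c$-pair reverses it, so $F_{ji}x_j=x_iG_{ij}$; in the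
-- same way $G_{ij}x_i=x_jF_{ji}$. The opposite orders of the pairs $c_ic_j$ and $e_je_i$ in
-- $G_{ij}$ are what make this work.
theorem Base.diagTerm_x_offTerm (hSx : SwapsWith η S x) {i j : Fin n} (hij : i ≠ j) :
    -(diagTerm η c e S j i * x j - x j * diagTerm η c e S j i) =
      offTerm η c e S i j * x i - x i * offTerm η c e S i j := by
  have hji := hij.symm
  have h1 : cliffPair η e j i * S j i * x j = η • (x i * (cliffPair η e j i * S j i)) := by
    rw [mul_assoc, hSx.left j i hji, mul_smul_comm, ← mul_assoc,
      cliffPair_commute_of_commute h.e_x, mul_assoc]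
  have h2 : cliffPair η e j i * S j i * x i = η • (x j * (cliffPair η e j i * S j i)) := by
    rw [mul_assoc, hSx.right j i hji, mul_smul_comm, ← mul_assoc,
      cliffPair_commute_of_commute h.e_x, mul_assoc]
  rw [diagTerm, offTerm, hS i j, mul_assoc (cliffPair η c j i), mul_assoc (cliffPair η c i j),
    smul_mul_assoc, mul_assoc (cliffPair η c j i), mul_assoc (cliffPair η c i j), h1, h2,
    mul_smul_comm, mul_smul_comm, smul_smul, hη, ← mul_assoc _ (x i), ← mul_assoc _ (x j),
    (cliffPair_mul_twisted h.c_x h.c_c hij).2.1, (cliffPair_mul_twisted h.c_x h.c_c hji).2.1]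
  simp only [mul_smul_comm, one_smul, mul_assoc]
  abel

include hη hS in
theorem Base.pairGood (hSx : SwapsWith η S x) (hSy : SwapsWith η S y) (hSc : SwapsWith η S c)
    (hSe : SwapsWith η S e) : PairGood x y c e (diagTerm η c e S) (offTerm η c e S) where
  c_F i j hij l := clifford_mul_pair hη h.c_sq h.c_c hij
    (fun l => cliffPair_commute_of_anticomm h.c_e l i j) hSc l
  e_F i j hij l := by
    rw [← h.diagTerm_symm]
    exact clifford_mul_pair hη h.e_sq h.e_e hij
      (fun l => cliffPair_commute_of_anticomm h.symm.c_e l i j) hSe l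
  c_G i j hij l := by
    rw [offTerm, mul_smul_comm, smul_mul_assoc, smul_comm (deltaSign l j)]
    exact congrArg _ (clifford_mul_pair hη h.c_sq h.c_c hij
      (fun l => cliffPair_commute_of_anticomm h.c_e l j i) hSc l)
  e_G i j hij l := by
    rw [← h.offTerm_symm hS, offTerm, mul_smul_comm, smul_mul_assoc, smul_comm (deltaSign l i)]
    exact congrArg _ (clifford_mul_pair hη h.e_sq h.e_e hij.symm
      (fun l => cliffPair_commute_of_anticomm h.symm.c_e l i j) hSe l)
  x_F i j l hij hi hj := h.pair_mul_x_of_ne hSx hij hi hj i j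
  x_G i j l hij hi hj := by
    rw [offTerm, mul_smul_comm, smul_mul_assoc, h.pair_mul_x_of_ne hSx hij hi hj]
  y_F i j l hij hi hj := by
    rw [← h.diagTerm_symm]
    exact h.symm.pair_mul_x_of_ne hSy hij hi hj i j
  y_G i j l hij hi hj := by
    rw [← h.offTerm_symm hS, offTerm, mul_smul_comm, smul_mul_assoc,
      h.symm.pair_mul_x_of_ne hSy hij.symm hj hi]
  F_x_G i j hij := h.diagTerm_x_offTerm hη hS hSx hij
  F_y_G i j hij := by
    -- The identity for $y$ is the one for $x$ under the exchange $(x,c)\leftrightarrow(y,e)$, with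
    -- $i$ and $j$ interchanged because the off-diagonal terms are transposed.
    have := h.symm.diagTerm_x_offTerm hη hS hSy hij.symm
    rw [h.diagTerm_symm, h.offTerm_symm hS] at this
    rw [neg_sub] at this ⊢
    rw [← neg_sub (y i * diagTerm η c e S i j), this, neg_sub]

/-- Conjugation by $g$ multiplies $\eta$ by the signs of $g$ at $i$ and $j$; when these differ, the
families $\eta=1$ and $\eta=-1$ are interchanged, which is why types $D$ and $B$ need both. -/
theorem Base.w_mul_cliffPair (g : W) (i j : Fin n) : w g * cliffPair η c i j =
    cliffPair (η * (sgn (ρ g) i * sgn (ρ g) j)) c ((ρ g).right i) ((ρ g).right j) * w g := by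
  have : w g * (c i * c j) = (sgn (ρ g) i * sgn (ρ g) j) •
      (c ((ρ g).right i) * c ((ρ g).right j) * w g) := by
    rw [← mul_assoc, h.w_c, smul_mul_assoc, mul_assoc, h.w_c, mul_smul_comm, smul_smul, mul_assoc]
  rw [cliffPair, cliffPair, mul_add, add_mul, mul_smul_comm, smul_mul_assoc, this, smul_smul,
    mul_one, one_mul]

variable {S' : Fin n → Fin n → B}

theorem Base.w_mul_diagTerm (g : W) (i j : Fin n)
    (hg : w g * S i j = S' ((ρ g).right i) ((ρ g).right j) * w g) :
    w g * diagTerm η c e S i j =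
      diagTerm (η * (sgn (ρ g) i * sgn (ρ g) j)) c e S' ((ρ g).right i) ((ρ g).right j) * w g := by
  rw [diagTerm, ← mul_assoc, ← mul_assoc, h.w_mul_cliffPair, mul_assoc _ (w g),
    h.symm.w_mul_cliffPair, ← mul_assoc, mul_assoc _ (w g), hg, diagTerm]
  simp only [mul_assoc]

theorem Base.w_mul_offTerm (g : W) (i j : Fin n)
    (hg : w g * S i j = S' ((ρ g).right i) ((ρ g).right j) * w g) :
    w g * offTerm η c e S i j = (sgn (ρ g) i * sgn (ρ g) j) •
      (offTerm (η * (sgn (ρ g) i * sgn (ρ g) j)) c e S' ((ρ g).right i) ((ρ g).right j) * w g) := by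
  have h1 : sgn (ρ g) i * sgn (ρ g) j * (η * (sgn (ρ g) i * sgn (ρ g) j)) = η := by
    linear_combination η * sgn (ρ g) j * sgn (ρ g) j * sgn_mul_self (ρ g) i +
      η * sgn_mul_self (ρ g) j
  rw [offTerm, offTerm, smul_mul_assoc, smul_smul, h1, mul_smul_comm, ← mul_assoc, ← mul_assoc,
    h.w_mul_cliffPair, mul_assoc _ (w g), h.symm.w_mul_cliffPair, ← mul_assoc, mul_assoc _ (w g),
    hg, mul_comm (sgn (ρ g) j)]
  simp only [mul_assoc]

end Terms

/-- The commutators assembled from their summands. -/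
def assemble (F G : Fin n → Fin n → B) (i j : Fin n) : B :=
  if i = j then -∑ k ∈ Finset.univ.erase i, F k i else G i j

theorem assemble_self (F G : Fin n → Fin n → B) (i : Fin n) :
    assemble F G i i = -∑ k ∈ Finset.univ.erase i, F k i := if_pos rfl

theorem assemble_of_ne (F G : Fin n → Fin n → B) {i j : Fin n} (h : i ≠ j) :
    assemble F G i j = G i j := if_neg h

/-- Every summand except the one with index $l$ commutes with $z$, so the commutator with the whole
diagonal sum collapses to one term. -/
theorem sum_erase_comm {F : Fin n → Fin n → B} {z : B} {i l : Fin n} (hil : i ≠ l)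
    (hz : ∀ k, k ≠ i → k ≠ l → F k i * z = z * F k i) :
    (∑ k ∈ Finset.univ.erase i, F k i) * z - z * ∑ k ∈ Finset.univ.erase i, F k i =
      F l i * z - z * F l i := by
  rw [Finset.sum_mul, Finset.mul_sum, ← Finset.sum_sub_distrib]
  refine Finset.sum_eq_single l (fun k hk hkl => ?_) (fun hl => ?_)
  · rw [hz k (Finset.ne_of_mem_erase hk) hkl, sub_self]
  · simp [hil.symm] at hl

/-- The Jacobi identity `k_x` is symmetric in $j,l$ and trivial for $j=l$. For distinct $i,j,l$ both
sides vanish, so only $i=j\ne l$ and its mirror image remain, where `sum_erase_comm` reduces it to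
`F_x_G`. The identity `y_k` is treated alike, with $i,j$ in the role of $j,l$. -/
theorem PairGood.good {F G : Fin n → Fin n → B} (h : PairGood x y c e F G)
    (wF : ∀ g i j, i ≠ j → w g * F i j = F ((ρ g).right i) ((ρ g).right j) * w g)
    (wG : ∀ g i j, i ≠ j → w g * G i j = (sgn (ρ g) i * sgn (ρ g) j) •
      (G ((ρ g).right i) ((ρ g).right j) * w g)) :
    Good ρ x y c e w (assemble F G) where
  c_k l i j := by
    by_cases hij : i = j
    · subst hij
      rw [assemble_self, mul_neg, neg_mul, smul_neg, Finset.mul_sum, Finset.sum_mul,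
        Finset.smul_sum]
      exact congrArg _ (Finset.sum_congr rfl fun k hk => h.c_F k i (Finset.ne_of_mem_erase hk) l)
    · rw [assemble_of_ne _ _ hij, h.c_G i j hij]
  e_k l i j := by
    by_cases hij : i = j
    · subst hij
      rw [assemble_self, mul_neg, neg_mul, smul_neg, Finset.mul_sum, Finset.sum_mul,
        Finset.smul_sum]
      exact congrArg _ (Finset.sum_congr rfl fun k hk => h.e_F k i (Finset.ne_of_mem_erase hk) l)
    · rw [assemble_of_ne _ _ hij, h.e_G i j hij]
  w_k g i j := by
    by_cases hij : i = j
    · subst hij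
      rw [assemble_self, assemble_self, sgn_mul_self, one_smul, mul_neg, neg_mul, Finset.mul_sum,
        Finset.sum_mul]
      refine congrArg _ (Finset.sum_equiv (ρ g).right (fun k => ?_) fun k hk => ?_)
      · simp
      · exact wF g k i (Finset.ne_of_mem_erase hk)
    · rw [assemble_of_ne _ _ hij, assemble_of_ne _ _ (by simpa using hij), wG g i j hij]
  k_x i j l := by
    have diag : ∀ i l, i ≠ l →
        assemble F G i i * x l - x l * assemble F G i i =
          assemble F G i l * x i - x i * assemble F G i l := by
      intro i l hil
      rw [assemble_self, assemble_of_ne _ _ hil, neg_mul, mul_neg, ← neg_sub', sum_erase_comm hil,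
        h.F_x_G i l hil]
      exact fun k hki hkl => h.x_F k i l hki hkl.symm hil.symm
    by_cases hjl : j = l
    · rw [hjl]
    by_cases hij : i = j
    · subst hij
      exact diag i l hjl
    by_cases hil : i = l
    · subst hil
      exact (diag i j hij).symm
    · rw [assemble_of_ne _ _ hij, assemble_of_ne _ _ hil, h.x_G i j l hij (Ne.symm hil)
        (Ne.symm hjl), h.x_G i l j hil (Ne.symm hij) hjl, sub_self, sub_self]
  y_k i j l := by
    have diag : ∀ i j, i ≠ j →
        y i * assemble F G j j - assemble F G j j * y i =
          y j * assemble F G i j - assemble F G i j * y j := by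
      intro i j hij
      rw [assemble_self, assemble_of_ne _ _ hij, neg_mul, mul_neg, ← h.F_y_G i j hij, ← neg_sub',
        ← neg_sub (_ * y i), ← neg_sub (F i j * y i), sum_erase_comm hij.symm]
      exact fun k hki hkl => h.y_F k j i hki hkl.symm hij
    by_cases hij : i = j
    · rw [hij]
    by_cases hjl : j = l
    · subst hjl
      exact diag i j hij
    by_cases hil : i = l
    · subst hil
      exact (diag j i (Ne.symm hij)).symm
    · rw [assemble_of_ne _ _ hjl, assemble_of_ne _ _ hil, h.y_G j l i hjl hij hil,
        h.y_G i l j hil (Ne.symm hij) hjl, sub_self, sub_self]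

end Local

/-! ### The parts with coefficients $t$ and $v$, and the combination of both signs -/

section Special
variable {n : ℕ} {W : Type} [Group W] {B : Type} [Ring B] [Algebra ℂ B]
  {ρ : W →* SignedPerm n} {x y c e : Fin n → B} {w : W → B}

/-- For a diagonal $k$ the Jacobi identities only require $k_{ii}$ to commute with $x_l$ and $y_l$
for $l\neq i$. This holds for $c_ie_i$, since the sign relations involve equal indices only. -/
theorem Base.good_clifford (h : Base ρ x y c e w) :
    Good ρ x y c e w (fun i j => if i = j then c i * e i else 0) where
  c_k l i j := by
    split_ifs with hij
    · subst hij
      by_cases hl : l = i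
      · subst hl
        rw [deltaSign_self, mul_assoc (c l) (e l), h.symm.c_e, mul_neg, smul_neg, neg_one_smul,
          neg_neg]
      · rw [deltaSign_of_ne hl, one_smul, ← mul_assoc, h.c_c l i hl, neg_mul, mul_assoc, h.c_e,
          mul_neg, neg_neg, mul_assoc]
    · simp
  e_k l i j := by
    split_ifs with hij
    · subst hij
      have hc : e l * c i = -(c i * e l) := h.symm.c_e l i
      by_cases hl : l = i
      · subst hl
        rw [deltaSign_self, ← mul_assoc, hc, neg_mul, neg_one_smul]
      · rw [deltaSign_of_ne hl, one_smul, ← mul_assoc, hc, neg_mul, mul_assoc, h.e_e l i hl,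
          mul_neg, neg_neg, mul_assoc]
    · simp
  w_k g i j := by
    by_cases hij : i = j
    · subst hij
      rw [if_pos rfl, if_pos rfl, ← mul_assoc, h.w_c, smul_mul_assoc, mul_assoc, h.w_e,
        mul_smul_comm, smul_smul, mul_assoc]
    · rw [if_neg hij, if_neg (by simpa using hij)]
      simp
  k_x i j l := by
    have key : ∀ i l, i ≠ l → c i * e i * x l - x l * (c i * e i) = 0 := by
      intro i l hil
      rw [mul_assoc, h.e_x, ← mul_assoc, h.c_x, deltaSign_of_ne hil, one_smul, mul_assoc, sub_self]
    by_cases hij : i = j <;> by_cases hil : i = l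
    · rw [← hij, ← hil]
    · subst hij; simp [hil, key i l hil]
    · subst hil; simp [hij, key i j hij]
    · simp [hij, hil]
  y_k i j l := by
    have key : ∀ i l, i ≠ l → y l * (c i * e i) - c i * e i * y l = 0 := by
      intro i l hil
      rw [mul_assoc, h.e_y, deltaSign_of_ne hil, one_smul, ← mul_assoc (c i), h.c_y, mul_assoc,
        sub_self]
    by_cases hjl : j = l <;> by_cases hil : i = l
    · rw [hil, hjl]
    · subst hjl; simpa [hil] using key j i (Ne.symm hil)
    · subst hil; simpa [hjl] using (key i j (Ne.symm hjl)).symm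
    · simp [hjl, hil]

/-- Again $k$ is diagonal, and the sign change at $i$ commutes with $x_l$ and $y_l$ for $l\ne i$. -/
theorem Base.good_reflection (h : Base ρ x y c e w) (T : Fin n → W)
    (hT : ∀ i, (ρ (T i)).right = 1) (hs : ∀ i j, sgn (ρ (T i)) j = deltaSign i j)
    (hconj : ∀ g i, g * T i = T ((ρ g).right i) * g) :
    Good ρ x y c e w (fun i j => if i = j then w (T i) else 0) where
  c_k l i j := by
    split_ifs with hij
    · subst hij
      rw [h.w_c, hs, hT, smul_smul]
      by_cases hl : l = i
      · subst hl; simp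
      · simp [deltaSign_of_ne hl, deltaSign_of_ne (Ne.symm hl)]
    · simp
  e_k l i j := by
    split_ifs with hij
    · subst hij
      rw [h.w_e, hs, hT, smul_smul]
      by_cases hl : l = i
      · subst hl; simp
      · simp [deltaSign_of_ne hl, deltaSign_of_ne (Ne.symm hl)]
    · simp
  w_k g i j := by
    by_cases hij : i = j
    · subst hij
      rw [if_pos rfl, if_pos rfl, sgn_mul_self, one_smul, h.w_mul, h.w_mul, hconj]
    · rw [if_neg hij, if_neg (by simpa using hij)]
      simp
  k_x i j l := by
    have key : ∀ i l, i ≠ l → w (T i) * x l - x l * w (T i) = 0 := by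
      intro i l hil
      rw [h.w_x, hs, hT, deltaSign_of_ne hil]
      simp
    by_cases hij : i = j <;> by_cases hil : i = l
    · rw [← hij, ← hil]
    · subst hij; simp [hil, key i l hil]
    · subst hil; simp [hij, key i j hij]
    · simp [hij, hil]
  y_k i j l := by
    have key : ∀ i l, i ≠ l → y l * w (T i) - w (T i) * y l = 0 := by
      intro i l hil
      rw [h.w_y, hs, hT, deltaSign_of_ne hil]
      simp
    by_cases hjl : j = l <;> by_cases hil : i = l
    · rw [hil, hjl]
    · subst hjl; simpa [hil] using key j i (Ne.symm hil)
    · subst hil; simpa [hjl] using (key i j (Ne.symm hjl)).symm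
    · simp [hjl, hil]

theorem swapsWith_of_group {η : ℂ} {S : Fin n → Fin n → W}
    (hr : ∀ i j, (ρ (S i j)).right = Equiv.swap i j)
    (hs : ∀ i j, i ≠ j → ∀ k, sgn (ρ (S i j)) k = if k = i ∨ k = j then η else 1) {z : Fin n → B}
    (hz : ∀ g i, w g * z i = sgn (ρ g) i • (z ((ρ g).right i) * w g)) :
    SwapsWith η (fun i j => w (S i j)) z where
  left i j hij := by rw [hz, hs i j hij, hr]; simp
  right i j hij := by rw [hz, hs i j hij, hr]; simp
  other i j l hij hi hj := by
    rw [hz, hs i j hij, hr, Equiv.swap_apply_of_ne_of_ne hi hj]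
    simp [hi, hj]

theorem Base.pairGood_of_group (h : Base ρ x y c e w) {η : ℂ} (hη : η * η = 1)
    {S : Fin n → Fin n → W} (hsymm : ∀ i j, S i j = S j i)
    (hr : ∀ i j, (ρ (S i j)).right = Equiv.swap i j)
    (hs : ∀ i j, i ≠ j → ∀ k, sgn (ρ (S i j)) k = if k = i ∨ k = j then η else 1) :
    PairGood x y c e (diagTerm η c e fun i j => w (S i j)) (offTerm η c e fun i j => w (S i j)) :=
  h.pairGood hη (fun i j => by rw [hsymm]) (swapsWith_of_group hr hs h.w_x)
    (swapsWith_of_group hr hs h.w_y) (swapsWith_of_group hr hs h.w_c)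
    (swapsWith_of_group hr hs h.w_e)

/-- The combination of both kinds of reflections is consistent. -/
theorem Base.good_signed (h : Base ρ x y c e w)
    {S S' : Fin n → Fin n → W} (hsymm : ∀ i j, S i j = S j i) (hsymm' : ∀ i j, S' i j = S' j i)
    (hr : ∀ i j, (ρ (S i j)).right = Equiv.swap i j)
    (hr' : ∀ i j, (ρ (S' i j)).right = Equiv.swap i j)
    (hs : ∀ i j k, sgn (ρ (S i j)) k = 1)
    (hs' : ∀ i j, i ≠ j → ∀ k, sgn (ρ (S' i j)) k = if k = i ∨ k = j then -1 else 1)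
    (hpos : ∀ g i j, i ≠ j → sgn (ρ g) i * sgn (ρ g) j = 1 →
      g * S i j = S ((ρ g).right i) ((ρ g).right j) * g ∧
      g * S' i j = S' ((ρ g).right i) ((ρ g).right j) * g)
    (hneg : ∀ g i j, i ≠ j → sgn (ρ g) i * sgn (ρ g) j = -1 →
      g * S i j = S' ((ρ g).right i) ((ρ g).right j) * g ∧
      g * S' i j = S ((ρ g).right i) ((ρ g).right j) * g) :
    Good ρ x y c e w (assemble
      ((diagTerm 1 c e fun i j => w (S i j)) + diagTerm (-1) c e fun i j => w (S' i j))
      ((offTerm 1 c e fun i j => w (S i j)) + offTerm (-1) c e fun i j => w (S' i j))) := by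
  have hsplit : ∀ g i j, sgn (ρ g) i * sgn (ρ g) j = 1 ∨ sgn (ρ g) i * sgn (ρ g) j = -1 := by
    intro g i j
    rcases sgn_eq_one_or (ρ g) i with h | h <;> rcases sgn_eq_one_or (ρ g) j with h' | h' <;>
      simp [h, h']
  refine PairGood.good ((h.pairGood_of_group (by simp) hsymm hr (fun i j _ k => by simp [hs])).add
    (h.pairGood_of_group (by simp) hsymm' hr' hs')) (fun g i j hij => ?_) fun g i j hij => ?_
  · simp only [Pi.add_apply, mul_add, add_mul]
    rcases hsplit g i j with hg | hg
    · obtain ⟨h1, h2⟩ := hpos g i j hij hg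
      rw [h.w_mul_diagTerm g i j (S' := fun i j => w (S i j)) (by simp only [h.w_mul, h1]),
        h.w_mul_diagTerm g i j (S' := fun i j => w (S' i j)) (by simp only [h.w_mul, h2]), hg]
      simp only [mul_one]
    -- Opposite signs at $i$ and $j$ exchange the two kinds of reflections and replace $\eta$ by
    -- $-\eta$, so the two summands trade places and the sum is preserved.
    · obtain ⟨h1, h2⟩ := hneg g i j hij hg
      rw [h.w_mul_diagTerm g i j (S' := fun i j => w (S' i j)) (by simp only [h.w_mul, h1]),
        h.w_mul_diagTerm g i j (S' := fun i j => w (S i j)) (by simp only [h.w_mul, h2]), hg]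
      simp only [one_mul, neg_mul, neg_neg]
      rw [add_comm]
  · simp only [Pi.add_apply, mul_add, add_mul, smul_add]
    rcases hsplit g i j with hg | hg
    · obtain ⟨h1, h2⟩ := hpos g i j hij hg
      rw [h.w_mul_offTerm g i j (S' := fun i j => w (S i j)) (by simp only [h.w_mul, h1]),
        h.w_mul_offTerm g i j (S' := fun i j => w (S' i j)) (by simp only [h.w_mul, h2]), hg]
      simp only [mul_one]
    · obtain ⟨h1, h2⟩ := hneg g i j hij hg
      rw [h.w_mul_offTerm g i j (S' := fun i j => w (S' i j)) (by simp only [h.w_mul, h1]),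
        h.w_mul_offTerm g i j (S' := fun i j => w (S i j)) (by simp only [h.w_mul, h2]), hg]
      simp only [one_mul, neg_mul, neg_neg]
      rw [add_comm]

end Special

/-! ### Conjugation of reflections by signed permutations -/

section SignedPermLemmas
variable {n : ℕ}

theorem signedPerm_ext {g h : SignedPerm n} (hr : g.right = h.right)
    (hs : ∀ i, sgn g i = sgn h i) : g = h := by
  refine SemidirectProduct.ext (funext fun i => ?_) hr
  have := hs (g.right.symm i)
  simp only [sgn, ← hr, Equiv.apply_symm_apply] at this
  exact Units.ext (by exact_mod_cast this)

@[simp] theorem transp_right (i j : Fin n) : (transp i j).right = Equiv.swap i j := rfl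

@[simp] theorem sgn_transp (i j k : Fin n) : sgn (transp i j) k = 1 := by simp [sgn, transp]

@[simp] theorem signChange_right (i : Fin n) : (signChange i).right = 1 := rfl

@[simp] theorem sgn_signChange (i j : Fin n) : sgn (signChange i) j = deltaSign i j := by
  by_cases h : i = j
  · subst h; simp [sgn, signChange]
  · simp [sgn, signChange, deltaSign_of_ne h, Ne.symm h]

@[simp] theorem transpBar_right (i j : Fin n) : (transpBar i j).right = Equiv.swap i j := by
  simp [transpBar]

theorem sgn_transpBar {i j : Fin n} (hij : i ≠ j) (k : Fin n) :
    sgn (transpBar i j) k = if k = i ∨ k = j then -1 else 1 := by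
  simp only [transpBar, sgn_mul, sgn_transp, signChange_right, sgn_signChange, transp_right, mul_one]
  by_cases hi : k = i
  · subst hi; simp [hij, deltaSign_of_ne]
  by_cases hj : k = j
  · subst hj; simp [deltaSign_of_ne hij.symm]
  · simp [Equiv.swap_apply_of_ne_of_ne hi hj, hi, hj, deltaSign_of_ne (Ne.symm hi),
      deltaSign_of_ne (Ne.symm hj)]

/-- A signed permutation is determined by its permutation and its signs. Conjugation by $g$ relabels
$i,j$ and multiplies the common sign at the two places by the product of the signs of $g$ there;
taking $a,a'=\pm1$ covers both kinds of reflections. -/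
theorem mul_eq_mul_of_swap {g A A' : SignedPerm n} {i j : Fin n} {a a' : ℂ}
    (hA : A.right = Equiv.swap i j) (hA' : A'.right = Equiv.swap (g.right i) (g.right j))
    (hs : ∀ k, sgn A k = if k = i ∨ k = j then a else 1)
    (hs' : ∀ k, sgn A' k = if k = g.right i ∨ k = g.right j then a' else 1)
    (ha : a' = a * (sgn g i * sgn g j)) : g * A = A' * g := by
  refine signedPerm_ext ?_ fun k => ?_
  · rw [SemidirectProduct.mul_right, SemidirectProduct.mul_right, hA, hA',
      Equiv.mul_swap_eq_swap_mul]
  · rw [sgn_mul, sgn_mul, hA, hs, hs', ha]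
    simp only [EmbeddingLike.apply_eq_iff_eq]
    by_cases hi : k = i
    · subst hi
      simp only [Equiv.swap_apply_left, true_or, if_true]
      linear_combination -sgn g j * a * sgn_mul_self g k
    by_cases hj : k = j
    · subst hj
      simp only [Equiv.swap_apply_right, or_true, if_true]
      linear_combination -sgn g i * a * sgn_mul_self g k
    · rw [Equiv.swap_apply_of_ne_of_ne hi hj, if_neg (by tauto), if_neg (by tauto), mul_comm]

theorem mul_signChange (g : SignedPerm n) (i : Fin n) :
    g * signChange i = signChange (g.right i) * g := by
  refine signedPerm_ext (by simp) fun k => ?_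
  rw [sgn_mul, sgn_mul, sgn_signChange, sgn_signChange, signChange_right, Equiv.Perm.one_apply,
    mul_comm]
  simp [deltaSign]

theorem transp_comm (i j : Fin n) : transp i j = transp j i := by
  rw [transp, transp, Equiv.swap_comm]

theorem transpBar_comm (i j : Fin n) : transpBar i j = transpBar j i := by
  rcases eq_or_ne i j with rfl | hij
  · rfl
  · refine signedPerm_ext (by simp [Equiv.swap_comm]) fun k => ?_
    rw [sgn_transpBar hij, sgn_transpBar hij.symm]
    simp only [or_comm]

theorem conj_of_pos (g : SignedPerm n) {i j : Fin n} (hij : i ≠ j)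
    (hg : sgn g i * sgn g j = 1) :
    g * transp i j = transp (g.right i) (g.right j) * g ∧
      g * transpBar i j = transpBar (g.right i) (g.right j) * g :=
  ⟨mul_eq_mul_of_swap (i := i) (j := j) (a := 1) (a' := 1) (by simp) (by simp) (by simp) (by simp)
      (by simp [hg]),
    mul_eq_mul_of_swap (by simp) (by simp) (sgn_transpBar hij)
      (sgn_transpBar (by simpa using hij)) (by simp [hg])⟩

theorem conj_of_neg (g : SignedPerm n) {i j : Fin n} (hij : i ≠ j)
    (hg : sgn g i * sgn g j = -1) :
    g * transp i j = transpBar (g.right i) (g.right j) * g ∧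
      g * transpBar i j = transp (g.right i) (g.right j) * g :=
  ⟨mul_eq_mul_of_swap (a := 1) (by simp) (by simp) (by simp) (sgn_transpBar (by simpa using hij))
      (by simp [hg]),
    mul_eq_mul_of_swap (a' := 1) (by simp) (by simp) (sgn_transpBar hij) (by simp)
      (by simp [hg])⟩

end SignedPermLemmas

/-! ### Consistency of the commutators in types A, D and B -/

section Types
variable {n : ℕ} {B : Type} [Ring B] [Algebra ℂ B] {x y c e : Fin n → B}

@[simp] theorem sgn_inclA (g : Equiv.Perm (Fin n)) (i : Fin n) : sgn (inclA n g) i = 1 := by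
  simp [sgn, inclA]

/-- The commutators are split by parameter so that the linearity of `Good` applies. The right-hand
side does not contain $y$, which also gives `eval_congr` in `Consistent`; the same holds in the
other two types. -/
theorem eval_kappaA (x y c e : Fin n → B) (w : Equiv.Perm (Fin n) → B) (t u : ℂ) (i j : Fin n) :
    eval x y c e w (kappaA n t u i j) =
      (t • (fun i j => if i = j then c i * e i else 0) +
        u • assemble (diagTerm 1 c e fun i j => w (Equiv.swap i j))
          (offTerm 1 c e fun i j => w (Equiv.swap i j))) i j := by
  unfold kappaA
  rcases eq_or_ne i j with rfl | hij
  · simp [assemble_self, diagTerm, cliffPair, sub_eq_add_neg]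
  · simp [hij, assemble_of_ne _ _ hij, offTerm, cliffPair]

theorem eval_kappaD (x y c e : Fin n → B) (w : evenSignedPerm n → B) (t u : ℂ) (i j : Fin n) :
    eval x y c e w (kappaD n t u i j) =
      (t • (fun i j => if i = j then c i * e i else 0) +
        u • assemble ((diagTerm 1 c e fun i j => w (transpD i j)) +
            diagTerm (-1) c e fun i j => w (transpBarD i j))
          ((offTerm 1 c e fun i j => w (transpD i j)) +
            offTerm (-1) c e fun i j => w (transpBarD i j))) i j := by
  unfold kappaD
  rcases eq_or_ne i j with rfl | hij
  · simp only [if_true, map_neg, map_smul, map_mul, map_sum, map_add, map_one, eval_fc, eval_fe,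
      eval_fw, Pi.add_apply, Pi.smul_apply, assemble_self, diagTerm, cliffPair, one_smul,
      neg_one_smul, Finset.sum_add_distrib, sub_eq_add_neg, neg_add, smul_add, smul_neg, add_assoc]
  · simp [hij, assemble_of_ne _ _ hij, offTerm, cliffPair, sub_eq_add_neg]

theorem eval_kappaB (x y c e : Fin n → B) (w : SignedPerm n → B) (t u v : ℂ) (i j : Fin n) :
    eval x y c e w (kappaB n t u v i j) =
      (t • (fun i j => if i = j then c i * e i else 0) +
        u • assemble ((diagTerm 1 c e fun i j => w (transp i j)) +
            diagTerm (-1) c e fun i j => w (transpBar i j))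
          ((offTerm 1 c e fun i j => w (transp i j)) +
            offTerm (-1) c e fun i j => w (transpBar i j)) +
        (-v) • fun i j => if i = j then w (signChange i) else 0) i j := by
  unfold kappaB
  rcases eq_or_ne i j with rfl | hij
  · simp only [if_true, map_neg, map_smul, map_mul, map_sum, map_add, map_one, eval_fc, eval_fe,
      eval_fw, Pi.add_apply, Pi.smul_apply, assemble_self, diagTerm, cliffPair, one_smul,
      Pi.neg_apply, Finset.sum_add_distrib, sub_eq_add_neg, neg_add, smul_add, smul_neg, neg_smul,
      add_assoc]
  · simp [hij, assemble_of_ne _ _ hij, offTerm, cliffPair, sub_eq_add_neg]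

/-- All signs are $1$ in the symmetric group, so the family with $\eta=1$ is stable under
conjugation on its own. -/
theorem good_kappaA {w : Equiv.Perm (Fin n) → B} (h : Base (inclA n) x y c e w) (t u : ℂ) :
    Good (inclA n) x y c e w (fun i j => eval x y c e w (kappaA n t u i j)) := by
  have hk : (fun i j => eval x y c e w (kappaA n t u i j)) = _ :=
    funext fun i => funext fun j => eval_kappaA x y c e w t u i j
  rw [hk]
  have hconj : ∀ (g : Equiv.Perm (Fin n)) (i j : Fin n),
      w g * w (Equiv.swap i j) = w (Equiv.swap (g i) (g j)) * w g := fun g i j => by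
    rw [h.w_mul, h.w_mul, Equiv.mul_swap_eq_swap_mul]
  refine (h.good_clifford.smul t).add (Good.smul (PairGood.good (h.pairGood_of_group (by simp)
    (fun i j => Equiv.swap_comm i j) (fun i j => rfl) (fun i j _ k => by simp))
    (fun g i j hij => ?_) (fun g i j hij => ?_)) u)
  · simpa using h.w_mul_diagTerm (η := 1) g i j (hconj g i j)
  · simpa using h.w_mul_offTerm (η := 1) g i j (hconj g i j)

theorem good_kappaD {w : evenSignedPerm n → B} (h : Base (evenSignedPerm n).subtype x y c e w)
    (t u : ℂ) : Good (evenSignedPerm n).subtype x y c e w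
      (fun i j => eval x y c e w (kappaD n t u i j)) := by
  have hk : (fun i j => eval x y c e w (kappaD n t u i j)) = _ :=
    funext fun i => funext fun j => eval_kappaD x y c e w t u i j
  rw [hk]
  refine (h.good_clifford.smul t).add (Good.smul (h.good_signed
    (fun i j => Subtype.ext (transp_comm i j)) (fun i j => Subtype.ext (transpBar_comm i j))
    (fun i j => transp_right i j) (fun i j => transpBar_right i j) (fun i j k => sgn_transp i j k)
    (fun i j hij k => sgn_transpBar hij k) (fun g i j hij hg => ?_) (fun g i j hij hg => ?_)) u)
  · exact (conj_of_pos g.1 hij hg).imp Subtype.ext Subtype.ext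
  · exact (conj_of_neg g.1 hij hg).imp Subtype.ext Subtype.ext

theorem good_kappaB {w : SignedPerm n → B} (h : Base (MonoidHom.id (SignedPerm n)) x y c e w)
    (t u v : ℂ) : Good (MonoidHom.id (SignedPerm n)) x y c e w
      (fun i j => eval x y c e w (kappaB n t u v i j)) := by
  have hk : (fun i j => eval x y c e w (kappaB n t u v i j)) = _ :=
    funext fun i => funext fun j => eval_kappaB x y c e w t u v i j
  rw [hk]
  exact ((h.good_clifford.smul t).add (Good.smul (h.good_signed transp_comm transpBar_comm
    transp_right transpBar_right sgn_transp (fun i j hij k => sgn_transpBar hij k)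
    (fun g i j hij hg => conj_of_pos g hij hg) (fun g i j hij hg => conj_of_neg g hij hg)) u)).add
    ((h.good_reflection signChange signChange_right sgn_signChange mul_signChange).smul (-v))

end Types

/-! ### The abstract hypothesis extracted from the three types -/

section Consistency
variable {n : ℕ} {W : Type} [Group W]

/-- The commutators `κ` do not involve the `y_i` and are consistent in every algebra. -/
structure Consistent (ρ : W →* SignedPerm n) (κ : Fin n → Fin n → Free n W) : Prop where
  eval_congr {B : Type} [Ring B] [Algebra ℂ B] (x y y' c e : Fin n → B) (w : W → B)
    (i j : Fin n) : eval x y c e w (κ i j) = eval x y' c e w (κ i j)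
  good {B : Type} [Ring B] [Algebra ℂ B] {x y c e : Fin n → B} {w : W → B}
    (h : Base ρ x y c e w) : Good ρ x y c e w (fun i j => eval x y c e w (κ i j))

theorem consistent_kappaA (t u : ℂ) : Consistent (inclA n) (kappaA n t u) where
  eval_congr x y y' c e w i j := by rw [eval_kappaA, eval_kappaA]
  good h := good_kappaA h t u

theorem consistent_kappaD (t u : ℂ) :
    Consistent (evenSignedPerm n).subtype (kappaD n t u) where
  eval_congr x y y' c e w i j := by rw [eval_kappaD, eval_kappaD]
  good h := good_kappaD h t u

theorem consistent_kappaB (t u v : ℂ) :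
    Consistent (MonoidHom.id (SignedPerm n)) (kappaB n t u v) where
  eval_congr x y y' c e w i j := by rw [eval_kappaB, eval_kappaB]
  good h := good_kappaB h t u v

end Consistency

/-! ### The positive part and the free module over it -/

section Positive
variable {n : ℕ} {W : Type} [Group W]

omit [Group W] in
theorem free_stable {V : Type} [AddCommMonoid V] [Module ℂ V]
    (f : Free n W →ₐ[ℂ] Module.End ℂ V) (T : Submodule ℂ V)
    (h : ∀ g m, m ∈ T → f (FreeAlgebra.ι ℂ g) m ∈ T) (a : Free n W) : ∀ m ∈ T, f a m ∈ T := by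
  induction a using FreeAlgebra.induction with
  | grade0 r => intro m hm; simpa using T.smul_mem r hm
  | grade1 g => exact h g
  | mul a b ha hb => intro m hm; simpa using ha _ (hb m hm)
  | add a b ha hb => intro m hm; simpa using T.add_mem (ha m hm) (hb m hm)

variable (ρ : W →* SignedPerm n)

/-- The relations of the subalgebra generated by the `x_i`, `c_i`, `e_i` and `W`. -/
inductive PosRel : Free n W → Free n W → Prop
  | of_rel {a b : Free n W} (h : Rel ρ 0 a b) : PosRel a b
  | y_zero (i : Fin n) : PosRel (fy i) 0

/-- The algebra generated by the `x_i`, `c_i`, `e_i` and `W`. -/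
def PosAlg : Type := RingQuot (PosRel ρ)

instance : Ring (PosAlg ρ) := inferInstanceAs (Ring (RingQuot (PosRel ρ)))

instance : Algebra ℂ (PosAlg ρ) := inferInstanceAs (Algebra ℂ (RingQuot (PosRel ρ)))

/-- The quotient map from the free algebra. -/
def posProj : Free n W →ₐ[ℂ] PosAlg ρ := RingQuot.mkAlgHom ℂ (PosRel ρ)

theorem posProj_eq {a b : Free n W} (h : PosRel ρ a b) : posProj ρ a = posProj ρ b :=
  RingQuot.mkAlgHom_rel ℂ h

theorem posProj_fy (i : Fin n) : posProj ρ (fy i) = 0 := by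
  rw [posProj_eq ρ (PosRel.y_zero i), map_zero]

theorem posProj_surjective : Function.Surjective (posProj ρ) := RingQuot.mkAlgHom_surjective _ _

/-- With all $y_i$ equal to $0$ and zero commutators, the relations containing $y$ are void; thus
`Rep` with these zeros encodes exactly the relations among $x$, $c$, $e$ and $W$. -/
theorem posProj_rep : Rep ρ 0 (fun i => posProj ρ (fx i)) 0 (fun i => posProj ρ (fc i))
    (fun i => posProj ρ (fe i)) (fun g => posProj ρ (fw g)) := by
  have h := Rep.of_map (ρ := ρ) (κ := 0) (posProj ρ)
    (fun a b hab => posProj_eq ρ (PosRel.of_rel hab))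
  have hy : (fun i => posProj ρ (fy i)) = 0 := funext (posProj_fy ρ)
  rw [hy] at h
  convert h using 2
  ext; simp

variable {ρ} in
/-- The algebra map defined by elements satisfying the relations. -/
def posLift {B : Type} [Ring B] [Algebra ℂ B] {x c e : Fin n → B} {w : W → B}
    (h : Rep ρ 0 x 0 c e w) : PosAlg ρ →ₐ[ℂ] B :=
  RingQuot.liftAlgHom ℂ ⟨eval x 0 c e w, fun a b hab => by
    cases hab with
    | of_rel hab =>
      have h0 : (fun i j => eval x 0 c e w ((0 : Fin n → Fin n → Free n W) i j)) = 0 := by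
        ext; simp
      exact Rep.eval_eq (κ := 0) (by rw [h0]; exact h) hab
    | y_zero i => simp⟩

variable {ρ} in
theorem posLift_posProj {B : Type} [Ring B] [Algebra ℂ B] {x c e : Fin n → B} {w : W → B}
    (h : Rep ρ 0 x 0 c e w) (a : Free n W) : posLift h (posProj ρ a) = eval x 0 c e w a :=
  RingQuot.liftAlgHom_mkAlgHom_apply ℂ _ _ a

/-- The free module over the positive part with basis the monomials in the `y_i`. -/
abbrev PBWModule : Type := (Fin n → ℕ) →₀ PosAlg ρ

/-- The left action of the positive part. -/
def posAct : PosAlg ρ →ₐ[ℂ] Module.End ℂ (PBWModule ρ) := Algebra.lsmul ℂ ℂ (PBWModule ρ)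

@[simp] theorem posAct_apply (p : PosAlg ρ) (m : PBWModule ρ) : posAct ρ p m = p • m := rfl

/-- A subspace stable under `x_i`, `c_i`, `e_i` and `W` which contains the monomials in the `y_i`
is everything. -/
theorem pbwModule_induction (T : Submodule ℂ (PBWModule ρ))
    (h1 : ∀ γ, Finsupp.single γ 1 ∈ T)
    (hx : ∀ i, ∀ m ∈ T, posProj ρ (fx i) • m ∈ T) (hc : ∀ i, ∀ m ∈ T, posProj ρ (fc i) • m ∈ T)
    (he : ∀ i, ∀ m ∈ T, posProj ρ (fe i) • m ∈ T) (hw : ∀ g, ∀ m ∈ T, posProj ρ (fw g) • m ∈ T)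
    (m : PBWModule ρ) : m ∈ T := by
  have stable : ∀ a : Free n W, ∀ m ∈ T, posProj ρ a • m ∈ T := by
    refine free_stable ((posAct ρ).comp (posProj ρ)) T fun g m hm => ?_
    cases g with
    | x i => exact hx i m hm
    | y i =>
      change posProj ρ (fy i) • m ∈ T
      rw [posProj_fy, zero_smul]
      exact T.zero_mem
    | c i => exact hc i m hm
    | e i => exact he i m hm
    | w g => exact hw g m hm
  induction m using Finsupp.induction_linear with
  | zero => exact T.zero_mem
  | add m m' hm hm' => exact T.add_mem hm hm'
  | single γ p =>
    obtain ⟨a, rfl⟩ := posProj_surjective ρ p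
    simpa using stable a _ (h1 γ)

end Positive

/-! ### The positive part acting on columns $((y_i m)_i, m)$ -/

section Extension
variable {n : ℕ} {W : Type} [Group W] {A : Type} [Ring A] [Algebra ℂ A]
  {M : Type} [AddCommGroup M] [Module A M] [Module ℂ M] [IsScalarTower ℂ A M]
  (ρ : W →* SignedPerm n)

/-- The action of `x` on pairs `((y_i m)_i, m)`. -/
def extX (x : A) (k : Fin n → A) : Module.End ℂ ((Fin n → M) × M) where
  toFun r := (fun i => x • r.1 i + k i • r.2, x • r.2)
  map_add' r r' := by
    refine Prod.ext (funext fun i => ?_) ?_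
    · simp only [Prod.fst_add, Prod.snd_add, Pi.add_apply, smul_add]; abel
    · simp
  map_smul' a r := by
    refine Prod.ext (funext fun i => ?_) ?_ <;> simp [smul_comm a]

/-- The action of an element commuting with the `y_i` up to signs. -/
def extSign (c : A) (s : Fin n → ℂ) : Module.End ℂ ((Fin n → M) × M) where
  toFun r := (fun i => s i • c • r.1 i, c • r.2)
  map_add' r r' := by
    refine Prod.ext (funext fun i => ?_) ?_ <;> simp
  map_smul' a r := by
    refine Prod.ext (funext fun i => ?_) ?_
    · simp [smul_comm a]
    · simp [smul_comm a]

/-- The action of a group element. -/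
def extGroup (w : A) (g : SignedPerm n) : Module.End ℂ ((Fin n → M) × M) where
  toFun r := (fun i => sgn g (g.right.symm i) • w • r.1 (g.right.symm i), w • r.2)
  map_add' r r' := by
    refine Prod.ext (funext fun i => ?_) ?_ <;> simp
  map_smul' a r := by
    refine Prod.ext (funext fun i => ?_) ?_
    · simp [smul_comm a]
    · simp [smul_comm a]

/-- The operators are the ones forced on $((y_im)_i,m)$ by the desired relations, such as
$y_ix_jm=x_jy_im+k_{ij}m$. They respect the relations of the positive part by the equivariance
conditions in `Good` and by the Jacobi identity `k_x`, which is used for $x_ix_j=x_jx_i$. The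
condition `y_k` is void here, as $y=0$. -/
theorem ext_rep {x c e : Fin n → A} {w : W → A} {k : Fin n → Fin n → A}
    (h : Rep ρ 0 x 0 c e w) (hk : Good ρ x 0 c e w k) :
    Rep ρ 0 (fun j => extX (M := M) (x j) (fun i => k i j)) 0 (fun l => extSign (c l) 1)
      (fun l => extSign (e l) (deltaSign l)) (fun g => extGroup (w g) (ρ g)) := by
  have smul_mul : ∀ (a b : A) (m : M), a • b • m = (a * b) • m := fun a b m => (mul_smul a b m).symm
  have hcomm : ∀ (a : A) (z : ℂ) (m : M), a • z • m = z • a • m := fun a z m => smul_comm a z m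
  have hdelta : ∀ g : W, ∀ i j, deltaSign ((ρ g).right i) ((ρ g).right j) = deltaSign i j := by
    intro g i j
    simp [deltaSign]
  refine { toBase := ⟨?_, ?_, ?_, ?_, ?_, ?_, ?_, ?_, ?_, ?_, ?_, ?_, ?_, ?_, ?_⟩
           x_x := ?_, y_y := ?_, y_x := ?_ }
  · refine LinearMap.ext fun r => Prod.ext (funext fun a => ?_) ?_
    · simp [extGroup, h.w_one, sgn]
      rfl
    · simp [extGroup, h.w_one]
  · intro g g'
    refine LinearMap.ext fun r => Prod.ext (funext fun a => ?_) ?_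
    · obtain ⟨a, rfl⟩ := (ρ g).right.surjective a
      obtain ⟨a, rfl⟩ := (ρ g').right.surjective a
      have h1 : (Equiv.symm ((ρ g).right * (ρ g').right)) ((ρ g).right ((ρ g').right a)) = a := by
        rw [Equiv.symm_apply_eq]; rfl
      simp [extGroup, hcomm, smul_mul, smul_smul, h.w_mul, sgn_mul, h1]
    · simp [extGroup, smul_mul, h.w_mul]
  · intro i
    refine LinearMap.ext fun r => Prod.ext (funext fun a => ?_) ?_ <;>
      simp [extSign, smul_mul, h.c_sq]
  · intro i
    refine LinearMap.ext fun r => Prod.ext (funext fun a => ?_) ?_ <;>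
      simp [extSign, smul_mul, h.e_sq, hcomm, smul_smul, deltaSign_mul_self]
  · intro i j hij
    refine LinearMap.ext fun r => Prod.ext (funext fun a => ?_) ?_ <;>
      simp [extSign, smul_mul, h.c_c i j hij]
  · intro i j hij
    refine LinearMap.ext fun r => Prod.ext (funext fun a => ?_) ?_ <;>
      simp [extSign, smul_mul, h.e_e i j hij, hcomm, smul_smul, mul_comm]
  · intro i j
    refine LinearMap.ext fun r => Prod.ext (funext fun a => ?_) ?_ <;>
      simp [extSign, smul_mul, h.c_e i j, hcomm]
  · intro g i
    refine LinearMap.ext fun r => Prod.ext (funext fun a => ?_) ?_ <;>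
      simp [extSign, extGroup, smul_mul, h.w_c, hcomm, smul_smul, mul_comm]
  · intro g i
    refine LinearMap.ext fun r => Prod.ext (funext fun a => ?_) ?_
    · obtain ⟨a, rfl⟩ := (ρ g).right.surjective a
      simp only [extSign, extGroup, Module.End.mul_apply, LinearMap.coe_mk, AddHom.coe_mk,
        LinearMap.smul_apply, Prod.smul_mk, Pi.smul_apply, Equiv.symm_apply_apply, hcomm, smul_mul,
        h.w_e, smul_smul, hdelta, smul_assoc]
      ring_nf
    · simp [extSign, extGroup, smul_mul, h.w_e]
  · intro g i
    refine LinearMap.ext fun r => Prod.ext (funext fun a => ?_) ?_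
    · obtain ⟨a, rfl⟩ := (ρ g).right.surjective a
      have h1 : sgn (ρ g) a * (sgn (ρ g) a * sgn (ρ g) i) = sgn (ρ g) i := by
        rw [← mul_assoc, sgn_mul_self, one_mul]
      simp [extX, extGroup, hcomm, smul_mul, h.w_x, hk.w_k, smul_smul, h1,
        mul_comm (sgn (ρ g) i)]
    · simp [extX, extGroup, smul_mul, h.w_x]
  · simp
  · intro i j
    refine LinearMap.ext fun r => Prod.ext (funext fun a => ?_) ?_
    · simp [extX, extSign, smul_mul, h.e_x, hk.e_k, hcomm, smul_smul, deltaSign_mul_self]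
    · simp [extX, extSign, smul_mul, h.e_x]
  · intro i j
    refine LinearMap.ext fun r => Prod.ext (funext fun a => ?_) ?_
    · simp [extX, extSign, smul_mul, h.c_x, hk.c_k]
    · simp [extX, extSign, smul_mul, h.c_x]
  · simp
  · simp
  · intro i j
    refine LinearMap.ext fun r => Prod.ext (funext fun a => ?_) ?_
    · have h1 : x i * k a j + k a i * x j = x j * k a i + k a j * x i := by
        have := hk.k_x a i j
        rw [sub_eq_sub_iff_add_eq_add] at this
        rw [add_comm, this, add_comm]
      simp [extX, smul_mul, h.x_x i j, add_assoc, ← add_smul, h1]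
    · simp [extX, smul_mul, h.x_x i j]
  · simp
  · simp

end Extension

/-! ### The action of the $y_i$ on the free module -/

section Module
variable {n : ℕ} {W : Type} [Group W] {ρ : W →* SignedPerm n} {κ : Fin n → Fin n → Free n W}

variable (ρ κ) in
/-- The commutators in the positive part. -/
def posKappa (i j : Fin n) : PosAlg ρ :=
  eval (fun i => posProj ρ (fx i)) 0 (fun i => posProj ρ (fc i)) (fun i => posProj ρ (fe i))
    (fun g => posProj ρ (fw g)) (κ i j)

theorem Consistent.posKappa_good (hκ : Consistent ρ κ) :
    Good ρ (fun i => posProj ρ (fx i)) 0 (fun i => posProj ρ (fc i)) (fun i => posProj ρ (fe i))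
      (fun g => posProj ρ (fw g)) (posKappa ρ κ) :=
  hκ.good (posProj_rep ρ).toBase

/-- The action of the positive part on pairs `((y_i m)_i, m)`. -/
def extAct (hκ : Consistent ρ κ) :
    PosAlg ρ →ₐ[ℂ] Module.End ℂ ((Fin n → PBWModule ρ) × PBWModule ρ) :=
  posLift (ext_rep ρ (posProj_rep ρ) hκ.posKappa_good)

/-- The pair `((y_i m)_i, m)` as a function of `m`. -/
def yPair (hκ : Consistent ρ κ) :
    PBWModule ρ →ₗ[ℂ] (Fin n → PBWModule ρ) × PBWModule ρ :=
  Finsupp.lsum ℂ fun γ => (LinearMap.applyₗ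
    ((fun j => Finsupp.single (γ + Pi.single j 1) 1, Finsupp.single γ 1) :
      (Fin n → PBWModule ρ) × PBWModule ρ)).comp (extAct hκ).toLinearMap

/-- The action of `y_i`. -/
def yAct (hκ : Consistent ρ κ) (i : Fin n) : Module.End ℂ (PBWModule ρ) :=
  (LinearMap.proj i).comp ((LinearMap.fst ℂ _ _).comp (yPair hκ))

theorem yPair_single (hκ : Consistent ρ κ) (γ : Fin n → ℕ) (p : PosAlg ρ) :
    yPair hκ (Finsupp.single γ p) = extAct hκ p
      ((fun j => Finsupp.single (γ + Pi.single j 1) 1, Finsupp.single γ 1)) := by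
  simp [yPair]

/-- `yPair` is prescribed on the basis $y^\gamma$ and extended along `extAct`; multiplicativity of
`extAct` makes it linear over the positive part. -/
theorem yPair_smul (hκ : Consistent ρ κ) (p : PosAlg ρ) (m : PBWModule ρ) :
    yPair hκ (p • m) = extAct hκ p (yPair hκ m) := by
  induction m using Finsupp.induction_linear with
  | zero => simp
  | add m m' hm hm' => rw [smul_add, map_add, map_add, map_add, hm, hm']
  | single γ q => rw [Finsupp.smul_single, yPair_single, yPair_single, smul_eq_mul, map_mul]; rfl

theorem yAct_single (hκ : Consistent ρ κ) (i : Fin n) (γ : Fin n → ℕ) :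
    yAct hκ i (Finsupp.single γ 1) = Finsupp.single (γ + Pi.single i 1) 1 := by
  simp [yAct, yPair_single]

theorem extAct_posProj (hκ : Consistent ρ κ) (a : Free n W) :
    extAct hκ (posProj ρ a) = eval
      (fun j => extX (posProj ρ (fx j)) (fun i => posKappa ρ κ i j)) 0
      (fun l => extSign (posProj ρ (fc l)) 1)
      (fun l => extSign (posProj ρ (fe l)) (deltaSign l))
      (fun g => extGroup (posProj ρ (fw g)) (ρ g)) a :=
  posLift_posProj _ a

/-- The second coordinate of each extended operator is the original action, and the coordinate is
right on the $y^\gamma$; hence the pair really has the form $((y_im)_i,m)$. -/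
theorem yPair_snd (hκ : Consistent ρ κ) (m : PBWModule ρ) : (yPair hκ m).2 = m := by
  refine pbwModule_induction ρ (LinearMap.eqLocus ((LinearMap.snd ℂ _ _).comp (yPair hκ))
    LinearMap.id) (fun γ => ?_) (fun i m hm => ?_) (fun i m hm => ?_) (fun i m hm => ?_)
    (fun i m hm => ?_) m
  · simp [yPair_single]
  all_goals
    replace hm : (yPair hκ m).2 = m := hm
    refine (congrArg Prod.snd (yPair_smul hκ _ m)).trans ?_
    rw [extAct_posProj]
    simp [extX, extSign, extGroup, hm]

theorem yPair_eq (hκ : Consistent ρ κ) (m : PBWModule ρ) :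
    yPair hκ m = (fun i => yAct hκ i m, m) :=
  Prod.ext rfl (yPair_snd hκ m)

/-- All the rules for moving $y_i$ past a generator are read off from this formula by inserting the
operator of that generator. -/
theorem yAct_smul (hκ : Consistent ρ κ) (i : Fin n) (p : PosAlg ρ) (m : PBWModule ρ) :
    yAct hκ i (p • m) = (extAct hκ p (fun i => yAct hκ i m, m)).1 i := by
  rw [← yPair_eq, ← yPair_smul]
  rfl

theorem yAct_x (hκ : Consistent ρ κ) (i j : Fin n) (m : PBWModule ρ) :
    yAct hκ i (posProj ρ (fx j) • m) =
      posProj ρ (fx j) • yAct hκ i m + posKappa ρ κ i j • m := by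
  rw [yAct_smul, extAct_posProj, eval_fx]
  rfl

theorem yAct_c (hκ : Consistent ρ κ) (i j : Fin n) (m : PBWModule ρ) :
    yAct hκ i (posProj ρ (fc j) • m) = posProj ρ (fc j) • yAct hκ i m := by
  rw [yAct_smul, extAct_posProj, eval_fc]
  simp [extSign]

theorem yAct_e (hκ : Consistent ρ κ) (i j : Fin n) (m : PBWModule ρ) :
    yAct hκ i (posProj ρ (fe j) • m) = deltaSign j i • posProj ρ (fe j) • yAct hκ i m := by
  rw [yAct_smul, extAct_posProj, eval_fe]
  rfl

theorem yAct_w (hκ : Consistent ρ κ) (i : Fin n) (g : W) (m : PBWModule ρ) :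
    yAct hκ ((ρ g).right i) (posProj ρ (fw g) • m) =
      sgn (ρ g) i • posProj ρ (fw g) • yAct hκ i m := by
  rw [yAct_smul, extAct_posProj, eval_fw]
  simp [extGroup]

theorem base_act (hκ : Consistent ρ κ) :
    Base ρ (fun i => posAct ρ (posProj ρ (fx i))) (yAct hκ)
      (fun i => posAct ρ (posProj ρ (fc i))) (fun i => posAct ρ (posProj ρ (fe i)))
      (fun g => posAct ρ (posProj ρ (fw g))) where
  w_one := by rw [(posProj_rep ρ).w_one, map_one]
  w_mul g g' := by rw [← map_mul, (posProj_rep ρ).w_mul]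
  c_sq i := by rw [← map_mul, (posProj_rep ρ).c_sq, map_one]
  e_sq i := by rw [← map_mul, (posProj_rep ρ).e_sq, map_one]
  c_c i j h := by rw [← map_mul, (posProj_rep ρ).c_c i j h, map_neg, map_mul]
  e_e i j h := by rw [← map_mul, (posProj_rep ρ).e_e i j h, map_neg, map_mul]
  c_e i j := by rw [← map_mul, (posProj_rep ρ).c_e i j, map_neg, map_mul]
  w_c g i := by rw [← map_mul, (posProj_rep ρ).w_c, map_smul, map_mul]
  w_e g i := by rw [← map_mul, (posProj_rep ρ).w_e, map_smul, map_mul]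
  w_x g i := by rw [← map_mul, (posProj_rep ρ).w_x, map_smul, map_mul]
  e_x i j := by rw [← map_mul, (posProj_rep ρ).e_x, map_mul]
  c_x i j := by rw [← map_mul, (posProj_rep ρ).c_x, map_smul, map_mul]
  w_y g i := LinearMap.ext fun m => by
    simp only [Module.End.mul_apply, LinearMap.smul_apply, posAct_apply, yAct_w, smul_smul,
      sgn_mul_self, one_smul]
  c_y i j := LinearMap.ext fun m => by
    simp only [Module.End.mul_apply, posAct_apply, yAct_c]
  e_y i j := LinearMap.ext fun m => by
    simp only [Module.End.mul_apply, LinearMap.smul_apply, posAct_apply, yAct_e, smul_smul,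
      deltaSign_mul_self, one_smul]

variable (ρ κ) in
theorem posAct_posKappa (i j : Fin n) :
    eval (fun i => posAct ρ (posProj ρ (fx i))) (fun _ => posAct ρ 0)
      (fun i => posAct ρ (posProj ρ (fc i))) (fun i => posAct ρ (posProj ρ (fe i)))
      (fun g => posAct ρ (posProj ρ (fw g))) (κ i j) = posAct ρ (posKappa ρ κ i j) := by
  have key := map_eval (B' := Module.End ℂ (PBWModule ρ)) (fun i => posProj ρ (fx i)) 0
    (fun i => posProj ρ (fc i)) (fun i => posProj ρ (fe i)) (fun g => posProj ρ (fw g))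
    (posAct ρ) (κ i j)
  exact key.symm

/-- The commutators do not involve $y$, so evaluating them with the true operators $y_i$ or with $0$
in their place gives the same result. -/
theorem eval_kappa_act (hκ : Consistent ρ κ) (i j : Fin n) :
    eval (fun i => posAct ρ (posProj ρ (fx i))) (yAct hκ)
      (fun i => posAct ρ (posProj ρ (fc i))) (fun i => posAct ρ (posProj ρ (fe i)))
      (fun g => posAct ρ (posProj ρ (fw g))) (κ i j) = posAct ρ (posKappa ρ κ i j) := by
  rw [← posAct_posKappa]
  exact hκ.eval_congr _ _ _ _ _ _ i j

/-- The relations `Base` do not include $y_iy_j=y_jy_i$, so `Good` is already available for the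
operators on the module. The vectors on which all $y_i,y_j$ commute contain the $y^\gamma$ and are
stable under the generators. All pairs $(i,j)$ are treated at once because $W$ permutes the indices.
-/
theorem yAct_comm (hκ : Consistent ρ κ) (i j : Fin n) (m : PBWModule ρ) :
    yAct hκ i (yAct hκ j m) = yAct hκ j (yAct hκ i m) := by
  have hgood := hκ.good (base_act hκ)
  simp only [eval_kappa_act] at hgood
  have h : m ∈ ⨅ i, ⨅ j, LinearMap.eqLocus (yAct hκ i * yAct hκ j) (yAct hκ j * yAct hκ i) := by
    have mem_iff : ∀ m, m ∈ ⨅ i, ⨅ j, LinearMap.eqLocus (yAct hκ i * yAct hκ j)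
        (yAct hκ j * yAct hκ i) ↔
        ∀ i j, yAct hκ i (yAct hκ j m) = yAct hκ j (yAct hκ i m) := by
      intro m
      simp only [Submodule.mem_iInf]
      rfl
    refine pbwModule_induction ρ _ (fun γ => ?_) (fun l m hm => ?_) (fun l m hm => ?_)
      (fun l m hm => ?_) (fun g m hm => ?_) m <;> rw [mem_iff] at * <;> intro i j
    · rw [yAct_single, yAct_single, yAct_single, yAct_single, add_right_comm]
    -- Expanding $y_iy_jx_lm$ leaves $k_{il}y_jm+y_ik_{jl}m$ besides $x_ly_iy_jm$; its symmetry in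
    -- $i,j$ is the Jacobi identity `y_k`.
    · have hy := DFunLike.congr_fun (hgood.y_k i j l) m
      simp only [LinearMap.sub_apply, Module.End.mul_apply, posAct_apply] at hy
      rw [sub_eq_sub_iff_add_eq_add] at hy
      rw [yAct_x, yAct_x, map_add, map_add, yAct_x, yAct_x, hm, add_assoc, add_assoc,
        add_comm (_ • _) (yAct hκ i _), hy, add_comm (_ • _) (yAct hκ j _)]
    · simp only [yAct_c, hm i j]
    · simp only [yAct_e, map_smul, hm i j, smul_comm (deltaSign l i)]
    · obtain ⟨i, rfl⟩ := (ρ g).right.surjective i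
      obtain ⟨j, rfl⟩ := (ρ g).right.surjective j
      simp only [yAct_w, map_smul, hm i j, smul_comm (sgn (ρ g) i)]
  simp only [Submodule.mem_iInf] at h
  exact h i j

theorem rep_act (hκ : Consistent ρ κ) :
    Rep ρ (fun i j => eval (fun i => posAct ρ (posProj ρ (fx i))) (yAct hκ)
      (fun i => posAct ρ (posProj ρ (fc i))) (fun i => posAct ρ (posProj ρ (fe i)))
      (fun g => posAct ρ (posProj ρ (fw g))) (κ i j))
      (fun i => posAct ρ (posProj ρ (fx i))) (yAct hκ)
      (fun i => posAct ρ (posProj ρ (fc i))) (fun i => posAct ρ (posProj ρ (fe i)))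
      (fun g => posAct ρ (posProj ρ (fw g))) where
  toBase := base_act hκ
  x_x i j := by rw [← map_mul, (posProj_rep ρ).x_x, map_mul]
  y_y i j := LinearMap.ext fun m => yAct_comm hκ i j m
  y_x i j := LinearMap.ext fun m => by
    rw [eval_kappa_act]
    simp only [LinearMap.sub_apply, Module.End.mul_apply, posAct_apply, yAct_x]
    rw [add_sub_cancel_left]

/-- The representation of the algebra on the free module over its positive part. -/
def act (hκ : Consistent ρ κ) : Alg ρ κ →ₐ[ℂ] Module.End ℂ (PBWModule ρ) :=
  RingQuot.liftAlgHom ℂ ⟨eval (fun i => posAct ρ (posProj ρ (fx i))) (yAct hκ)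
      (fun i => posAct ρ (posProj ρ (fc i))) (fun i => posAct ρ (posProj ρ (fe i)))
      (fun g => posAct ρ (posProj ρ (fw g))), (rep_act hκ).eval_eq⟩

theorem act_proj (hκ : Consistent ρ κ) (a : Free n W) : act hκ (proj ρ κ a) =
    eval (fun i => posAct ρ (posProj ρ (fx i))) (yAct hκ)
      (fun i => posAct ρ (posProj ρ (fc i))) (fun i => posAct ρ (posProj ρ (fe i)))
      (fun g => posAct ρ (posProj ρ (fw g))) a :=
  RingQuot.liftAlgHom_mkAlgHom_apply ℂ _ _ a

end Module

/-! ### Ordered monomials in elements commuting up to scalars -/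

section OrderedMonomials

theorem orderedMonomial_succ {A : Type} [Monoid A] {n : ℕ} (a : Fin (n + 1) → A)
    (m : Fin (n + 1) → ℕ) :
    orderedMonomial a m = a 0 ^ m 0 * orderedMonomial (fun i => a i.succ) (fun i => m i.succ) := by
  simp [orderedMonomial, List.ofFn_succ]

theorem orderedMonomial_zero {A : Type} [Monoid A] {n : ℕ} (a : Fin n → A) :
    orderedMonomial a 0 = 1 := by
  induction n with
  | zero => rfl
  | succ n ih =>
    rw [orderedMonomial_succ, Pi.zero_apply, pow_zero, one_mul]
    exact ih _

theorem map_orderedMonomial {A A' F : Type} [Monoid A] [Monoid A'] [FunLike F A A']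
    [MonoidHomClass F A A'] (f : F) {n : ℕ} (a : Fin n → A) (m : Fin n → ℕ) :
    f (orderedMonomial a m) = orderedMonomial (fun i => f (a i)) m := by
  rw [orderedMonomial, map_list_prod, List.map_ofFn]
  simp [orderedMonomial, Function.comp_def]

theorem orderedMonomial_congr {A : Type} [Monoid A] {n : ℕ} {a : Fin n → A} {m m' : Fin n → ℕ}
    (h : ∀ i, a i ^ m i = a i ^ m' i) : orderedMonomial a m = orderedMonomial a m' := by
  rw [orderedMonomial, orderedMonomial, funext h]

theorem orderedMonomial_mod_two {A : Type} [Monoid A] {n : ℕ} {a : Fin n → A}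
    (ha : ∀ i, a i * a i = 1) (m : Fin n → ℕ) :
    orderedMonomial a m = orderedMonomial a fun i => ((m i : ℕ) : ZMod 2).val := by
  refine orderedMonomial_congr fun i => ?_
  rw [ZMod.val_natCast]
  conv_lhs => rw [← Nat.div_add_mod (m i) 2, pow_add, pow_mul, sq, ha, one_pow, one_mul]

variable {B : Type} [Ring B] [Algebra ℂ B]

/-- `a` and `b` commute up to a scalar in `S`. -/
def SComm (S : Subgroup ℂˣ) (a b : B) : Prop := ∃ s ∈ S, a * b = s • (b * a)

variable {S : Subgroup ℂˣ}

theorem SComm.one_right (a : B) : SComm S a 1 := ⟨1, S.one_mem, by simp⟩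

theorem SComm.symm {a b : B} (h : SComm S a b) : SComm S b a := by
  obtain ⟨s, hs, h⟩ := h
  exact ⟨s⁻¹, S.inv_mem hs, by rw [h, smul_smul, inv_mul_cancel, one_smul]⟩

theorem SComm.mul_right {a b b' : B} (h : SComm S a b) (h' : SComm S a b') :
    SComm S a (b * b') := by
  obtain ⟨s, hs, h⟩ := h
  obtain ⟨s', hs', h'⟩ := h'
  refine ⟨s * s', S.mul_mem hs hs', ?_⟩
  rw [← mul_assoc, h, smul_mul_assoc, mul_assoc, h', mul_smul_comm, smul_smul, mul_assoc]

theorem SComm.pow_right {a b : B} (h : SComm S a b) (k : ℕ) : SComm S a (b ^ k) := by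
  induction k with
  | zero => simpa using SComm.one_right a
  | succ k ih => rw [pow_succ]; exact ih.mul_right h

theorem SComm.orderedMonomial_right {n : ℕ} {a : B} {b : Fin n → B}
    (h : ∀ i, SComm S a (b i)) (m : Fin n → ℕ) : SComm S a (orderedMonomial b m) := by
  induction n with
  | zero => exact SComm.one_right a
  | succ n ih =>
    rw [orderedMonomial_succ]
    exact ((h 0).pow_right _).mul_right (ih (fun i => h i.succ) _)

/-- The factor $a_i$ is moved to its place and collects scalars from $S$. The choice $S=\bot$ gives
exact identities for commuting elements, and $S=\top$ covers Clifford generators. -/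
theorem mul_orderedMonomial {n : ℕ} {a : Fin n → B} (h : ∀ i j, i ≠ j → SComm S (a i) (a j))
    (i : Fin n) (m : Fin n → ℕ) :
    ∃ s ∈ S, a i * orderedMonomial a m = s • orderedMonomial a (m + Pi.single i 1) := by
  induction n with
  | zero => exact i.elim0
  | succ n ih =>
    rw [orderedMonomial_succ, orderedMonomial_succ]
    refine Fin.cases ?_ (fun i => ?_) i
    · refine ⟨1, S.one_mem, ?_⟩
      have : (fun i : Fin n => (m + Pi.single 0 1 : Fin (n + 1) → ℕ) i.succ) =
          fun i => m i.succ := by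
        funext i
        simp
      rw [this, one_smul, ← mul_assoc, ← pow_succ']
      simp
    · obtain ⟨s, hs, h1⟩ := (h i.succ 0 (Fin.succ_ne_zero i)).pow_right (m 0)
      obtain ⟨s', hs', h2⟩ := ih (a := fun i => a i.succ)
        (fun i j hij => h i.succ j.succ (by simpa using hij)) i (fun i => m i.succ)
      refine ⟨s * s', S.mul_mem hs hs', ?_⟩
      have : (fun j : Fin n => (m + Pi.single i.succ 1 : Fin (n + 1) → ℕ) j.succ) =
          (fun j => m j.succ) + Pi.single i 1 := by
        funext j
        simp [Pi.single_apply]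
      rw [this, ← mul_assoc, h1, smul_mul_assoc, mul_assoc, h2, mul_smul_comm, smul_smul]
      simp

/-- A monomial in operators that shift basis vectors up to scalars shifts basis vectors. -/
theorem orderedMonomial_apply {V : Type} [AddCommMonoid V] [Module ℂ V] {X : Type}
    [AddCommMonoid X] (b : X → V) {n : ℕ} (a : Fin n → Module.End ℂ V) (d : Fin n → X)
    (h : ∀ i p, ∃ s : ℂˣ, a i (b p) = s • b (p + d i)) (m : Fin n → ℕ) (p : X) :
    ∃ s : ℂˣ, orderedMonomial a m (b p) = s • b (p + ∑ i, m i • d i) := by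
  induction n generalizing p with
  | zero => exact ⟨1, by simp [orderedMonomial]⟩
  | succ n ih =>
    obtain ⟨s, hs⟩ := ih (fun i => a i.succ) (fun i => d i.succ) (fun i => h i.succ)
      (fun i => m i.succ) p
    have hpow : ∀ (k : ℕ) (q : X), ∃ s : ℂˣ, (a 0 ^ k) (b q) = s • b (q + k • d 0) := by
      intro k
      induction k with
      | zero => exact fun q => ⟨1, by simp⟩
      | succ k ihk =>
        intro q
        obtain ⟨s, hs⟩ := ihk q
        obtain ⟨s', hs'⟩ := h 0 (q + k • d 0)
        refine ⟨s * s', ?_⟩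
        rw [pow_succ', Module.End.mul_apply, hs, Units.smul_def, map_smul, hs', ← Units.smul_def,
          smul_smul, succ_nsmul, add_assoc]
    obtain ⟨s', hs'⟩ := hpow (m 0) (p + ∑ i : Fin n, m i.succ • d i.succ)
    refine ⟨s * s', ?_⟩
    rw [orderedMonomial_succ, Module.End.mul_apply, hs, Units.smul_def, map_smul, hs',
      ← Units.smul_def, smul_smul, Fin.sum_univ_succ, add_assoc, add_comm (m 0 • d 0)]

/-- Stability under left multiplication by the generators passes to the subalgebra, which is then
applied to $1$; $T$ need not be closed under products. -/
theorem adjoin_le_of_stable {n : ℕ} {a : Fin n → B} {T : Submodule ℂ B} (h1 : (1 : B) ∈ T)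
    (h : ∀ i, ∀ t ∈ T, a i * t ∈ T) :
    Subalgebra.toSubmodule (Algebra.adjoin ℂ (Set.range a)) ≤ T := by
  intro z hz
  have key : ∀ t ∈ T, z * t ∈ T := by
    refine Algebra.adjoin_induction (p := fun z _ => ∀ t ∈ T, z * t ∈ T) ?_ ?_ ?_ ?_ hz
    · rintro _ ⟨i, rfl⟩
      exact h i
    · intro r t ht
      rw [Algebra.algebraMap_eq_smul_one, smul_mul_assoc, one_mul]
      exact T.smul_mem r ht
    · intro z z' _ _ hz hz' t ht
      rw [add_mul]
      exact T.add_mem (hz t ht) (hz' t ht)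
    · intro z z' _ _ hz hz' t ht
      rw [mul_assoc]
      exact hz _ (hz' t ht)
  simpa using key 1 h1

theorem adjoin_le_span_orderedMonomial {n : ℕ} {a : Fin n → B}
    (h : ∀ i j, i ≠ j → SComm S (a i) (a j)) :
    Subalgebra.toSubmodule (Algebra.adjoin ℂ (Set.range a)) ≤
      Submodule.span ℂ (Set.range (orderedMonomial a)) := by
  refine adjoin_le_of_stable (Submodule.subset_span ⟨0, orderedMonomial_zero a⟩) fun i t ht => ?_
  induction ht using Submodule.span_induction with
  | mem t ht =>
    obtain ⟨m, rfl⟩ := ht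
    obtain ⟨s, _, hs⟩ := mul_orderedMonomial h i m
    rw [hs, Units.smul_def]
    exact Submodule.smul_mem _ _ (Submodule.subset_span ⟨_, rfl⟩)
  | zero => simp
  | add t t' _ _ ht ht' => rw [mul_add]; exact Submodule.add_mem _ ht ht'
  | smul r t _ ht => rw [mul_smul_comm]; exact Submodule.smul_mem _ _ ht

theorem sComm_of_anticomm {a b : B} (h : a * b = -(b * a)) : SComm (⊤ : Subgroup ℂˣ) a b :=
  ⟨-1, trivial, by rw [h, Units.smul_def]; simp⟩

theorem sComm_of_comm {a b : B} (h : a * b = b * a) : SComm S a b :=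
  ⟨1, S.one_mem, by rw [h, one_smul]⟩

theorem adjoin_le_span_clifford {n : ℕ} {a : Fin n → B} (ha : ∀ i, a i * a i = 1)
    (h : ∀ i j, i ≠ j → a i * a j = -(a j * a i)) :
    Subalgebra.toSubmodule (Algebra.adjoin ℂ (Set.range a)) ≤ Submodule.span ℂ
      (Set.range fun ε : Fin n → ZMod 2 => orderedMonomial a fun i => (ε i).val) := by
  refine (adjoin_le_span_orderedMonomial fun i j hij => sComm_of_anticomm (h i j hij)).trans
    (Submodule.span_mono ?_)
  rintro _ ⟨m, rfl⟩
  exact ⟨fun i => (m i : ZMod 2), (orderedMonomial_mod_two ha m).symm⟩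

/-- If `g` can be moved past the generators, it can be moved past the subalgebra. -/
theorem exists_mul_eq_mul_of_adjoin {n : ℕ} {a : Fin n → B} {g : B}
    (h : ∀ i, ∃ z' ∈ Algebra.adjoin ℂ (Set.range a), g * a i = z' * g) {z : B}
    (hz : z ∈ Algebra.adjoin ℂ (Set.range a)) :
    ∃ z' ∈ Algebra.adjoin ℂ (Set.range a), g * z = z' * g := by
  induction hz using Algebra.adjoin_induction with
  | mem z hz => obtain ⟨i, rfl⟩ := hz; exact h i
  | algebraMap r => exact ⟨_, Subalgebra.algebraMap_mem _ r, (Algebra.commutes r g).symm⟩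
  | add z z' _ _ hz hz' =>
    obtain ⟨u, hu, h1⟩ := hz
    obtain ⟨u', hu', h2⟩ := hz'
    exact ⟨u + u', add_mem hu hu', by rw [mul_add, h1, h2, add_mul]⟩
  | mul z z' _ _ hz hz' =>
    obtain ⟨u, hu, h1⟩ := hz
    obtain ⟨u', hu', h2⟩ := hz'
    exact ⟨u * u', mul_mem hu hu', by rw [← mul_assoc, h1, mul_assoc, h2, mul_assoc]⟩

/-- The element $g$ passes through the left factor unchanged and is absorbed by the right one; this
is the reordering step for the spanning statement. -/
theorem mul_mem_mul_of_pass {T R : Submodule ℂ B} {g : B}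
    (hT : ∀ t ∈ T, ∃ t' ∈ T, g * t = t' * g) (hR : ∀ r ∈ R, g * r ∈ R) {z : B} (hz : z ∈ T * R) :
    g * z ∈ T * R := by
  refine Submodule.mul_induction_on hz (fun t ht r hr => ?_) fun z z' hz hz' => ?_
  · obtain ⟨t', ht', h⟩ := hT t ht
    rw [← mul_assoc, h, mul_assoc]
    exact Submodule.mul_mem_mul ht' (hR r hr)
  · rw [mul_add]
    exact Submodule.add_mem _ hz hz'

theorem mul_mem_mul_of_left {T R : Submodule ℂ B} {g : B}
    (hT : ∀ t ∈ T, g * t ∈ T) {z : B} (hz : z ∈ T * R) : g * z ∈ T * R := by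
  refine Submodule.mul_induction_on hz (fun t ht r hr => ?_) fun z z' hz hz' => ?_
  · rw [← mul_assoc]
    exact Submodule.mul_mem_mul (hT t ht) hr
  · rw [mul_add]
    exact Submodule.add_mem _ hz hz'

end OrderedMonomials

/-! ### A model of the positive part on $W\times$ exponents, and independence of its monomials -/

section Model
variable {n : ℕ} {W : Type} [Group W] (ρ : W →* SignedPerm n)

/-- The nontrivial character of `ℤ / 2`. -/
def paritySign (a : ZMod 2) : ℂ := if a = 0 then 1 else -1

@[simp] theorem paritySign_zero : paritySign 0 = 1 := by simp [paritySign]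

@[simp] theorem paritySign_one : paritySign 1 = -1 := by simp [paritySign]

theorem zmod_two_cases : ∀ a : ZMod 2, a = 0 ∨ a = 1 := by decide

theorem paritySign_add (a b : ZMod 2) : paritySign (a + b) = paritySign a * paritySign b := by
  have h2 : (1 : ZMod 2) + 1 = 0 := rfl
  rcases zmod_two_cases a with rfl | rfl <;> rcases zmod_two_cases b with rfl | rfl <;> simp [h2]

theorem paritySign_mul_self (a : ZMod 2) : paritySign a * paritySign a = 1 := by
  rcases zmod_two_cases a with rfl | rfl <;> simp

theorem paritySign_ne_zero (a : ZMod 2) : paritySign a ≠ 0 := by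
  rcases zmod_two_cases a with rfl | rfl <;> simp

theorem sgn_ne_zero (g : SignedPerm n) (i : Fin n) : sgn g i ≠ 0 := by
  rcases sgn_eq_one_or g i with h | h <;> simp [h]

/-- The exponents `(α, ε, ε')` of the monomials `x^α c^ε e^{ε'}`. -/
abbrev Exponent (n : ℕ) : Type := (Fin n → ℕ) × (Fin n → ZMod 2) × (Fin n → ZMod 2)

/-- The operator induced from the shift of `x^α c^ε e^{ε'}` by `d` with the signs given by `l`. -/
def shiftOp (d : Fin n → Exponent n) (l : Fin n → Exponent n →+ ZMod 2) (k : Fin n) :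
    Module.End ℂ (W × Exponent n →₀ ℂ) :=
  Finsupp.lsum ℂ fun q =>
    (sgn (ρ q.1) ((ρ q.1).right.symm k) * paritySign (l ((ρ q.1).right.symm k) q.2)) •
      Finsupp.lsingle (q.1, q.2 + d ((ρ q.1).right.symm k))

/-- The operator of translation by a group element. -/
def translateOp (g : W) : Module.End ℂ (W × Exponent n →₀ ℂ) :=
  Finsupp.lsum ℂ fun q => Finsupp.lsingle (g * q.1, q.2)

/-- The basis vector $(g,p)$ stands for $g\,x^\alpha c^\epsilon e^{\epsilon'}$, with the group
element on the left. Since $z_{g(k)}\,g=\pm g\,z_k$, indexing the operator by $g(k)$ removes the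
inverse permutation. -/
theorem shiftOp_single (d : Fin n → Exponent n) (l : Fin n → Exponent n →+ ZMod 2) (k : Fin n)
    (g : W) (p : Exponent n) : shiftOp ρ d l ((ρ g).right k) (Finsupp.single (g, p) 1) =
      (sgn (ρ g) k * paritySign (l k p)) • Finsupp.single (g, p + d k) 1 := by
  simp [shiftOp]

theorem translateOp_single (h g : W) (p : Exponent n) :
    translateOp h (Finsupp.single (g, p) (1 : ℂ)) = Finsupp.single (h * g, p) 1 := by
  simp [translateOp]

omit [Group W] in
theorem model_ext {f f' : Module.End ℂ (W × Exponent n →₀ ℂ)}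
    (h : ∀ g p, f (Finsupp.single (g, p) 1) = f' (Finsupp.single (g, p) 1)) : f = f' :=
  Finsupp.lhom_ext' fun ⟨g, p⟩ => LinearMap.ext_ring (h g p)

/-- As the parities are additive, the two orders differ only by the parity of one shift evaluated on
the other. The parities depend on the order of the indices, which $W$ does not preserve, so the sign
condition is required after every permutation; the resulting scalar $s$ must be invariant. -/
theorem shiftOp_comm {d d' : Fin n → Exponent n} {l l' : Fin n → Exponent n →+ ZMod 2}
    {s : Fin n → Fin n → ℂ} {i j : Fin n}
    (hs : ∀ σ : Equiv.Perm (Fin n), s (σ i) (σ j) = s i j)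
    (h : ∀ σ : Equiv.Perm (Fin n), paritySign (l (σ i) (d' (σ j))) =
      s (σ i) (σ j) * paritySign (l' (σ j) (d (σ i)))) :
    shiftOp ρ d l i * shiftOp ρ d' l' j = s i j • (shiftOp ρ d' l' j * shiftOp ρ d l i) := by
  refine model_ext fun g p => ?_
  obtain ⟨i', hi⟩ := (ρ g).right.surjective i
  obtain ⟨j', hj⟩ := (ρ g).right.surjective j
  have h1 := h (ρ g).right.symm
  have h2 := hs (ρ g).right.symm
  rw [h2, ← hi, ← hj, Equiv.symm_apply_apply, Equiv.symm_apply_apply] at h1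
  rw [LinearMap.smul_apply, Module.End.mul_apply, Module.End.mul_apply]
  subst hi hj
  rw [shiftOp_single, shiftOp_single, map_smul, map_smul, shiftOp_single, shiftOp_single,
    smul_smul, smul_smul, smul_smul, map_add, map_add, paritySign_add, paritySign_add, h1,
    add_right_comm]
  congr 1
  ring

theorem shiftOp_anticomm {d d' : Fin n → Exponent n} {l l' : Fin n → Exponent n →+ ZMod 2}
    {i j : Fin n} (h : ∀ σ : Equiv.Perm (Fin n), paritySign (l (σ i) (d' (σ j))) =
      -1 * paritySign (l' (σ j) (d (σ i)))) :
    shiftOp ρ d l i * shiftOp ρ d' l' j = -(shiftOp ρ d' l' j * shiftOp ρ d l i) := by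
  rw [shiftOp_comm ρ (s := fun _ _ => -1) (fun σ => rfl) h]
  refine LinearMap.ext fun m => ?_
  rw [LinearMap.smul_apply, LinearMap.neg_apply, neg_one_smul]

theorem shiftOp_sq {d : Fin n → Exponent n} {l : Fin n → Exponent n →+ ZMod 2} (i : Fin n)
    (hd : ∀ i, d i + d i = 0) (hl : ∀ i, l i (d i) = 0) :
    shiftOp ρ d l i * shiftOp ρ d l i = 1 := by
  refine model_ext fun g p => ?_
  obtain ⟨i, rfl⟩ := (ρ g).right.surjective i
  rw [Module.End.mul_apply, shiftOp_single, map_smul, shiftOp_single, smul_smul, map_add, hl,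
    add_zero, add_assoc, hd, add_zero, mul_mul_mul_comm, sgn_mul_self, paritySign_mul_self,
    one_mul, one_smul, Module.End.one_apply]

theorem translateOp_shiftOp (d : Fin n → Exponent n) (l : Fin n → Exponent n →+ ZMod 2) (h : W)
    (i : Fin n) : translateOp h * shiftOp ρ d l i =
      sgn (ρ h) i • (shiftOp ρ d l ((ρ h).right i) * translateOp h) := by
  refine model_ext fun g p => ?_
  obtain ⟨i, rfl⟩ := (ρ g).right.surjective i
  have h1 : (ρ h).right ((ρ g).right i) = (ρ (h * g)).right i := by rw [map_mul]; rfl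
  rw [LinearMap.smul_apply, Module.End.mul_apply, Module.End.mul_apply, shiftOp_single, map_smul,
    translateOp_single, translateOp_single, h1, shiftOp_single, smul_smul, map_mul, sgn_mul,
    ← mul_assoc, ← mul_assoc, sgn_mul_self, one_mul]

variable (n) in
/-- The shift by `x_i`. -/
def xShift (i : Fin n) : Exponent n := (Pi.single i 1, 0, 0)

variable (n) in
/-- The shift by `c_i`. -/
def cShift (i : Fin n) : Exponent n := (0, Pi.single i 1, 0)

variable (n) in
/-- The shift by `e_i`. -/
def eShift (i : Fin n) : Exponent n := (0, 0, Pi.single i 1)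

variable (n) in
/-- The sign picked up by `c_i`. -/
def cParity (i : Fin n) : Exponent n →+ ZMod 2 where
  -- To reach its place in $x^\alpha c^\epsilon e^{\epsilon'}$, $c_i$ anticommutes past
  -- $x_i^{\alpha_i}$ and past the $c_j$ with $j<i$.
  toFun p := (p.1 i : ZMod 2) + ∑ j ∈ Finset.univ.filter (· < i), p.2.1 j
  map_zero' := by simp
  map_add' p q := by
    simp only [Prod.fst_add, Prod.snd_add, Pi.add_apply, Nat.cast_add, Finset.sum_add_distrib]
    ring

variable (n) in
/-- The sign picked up by `e_i`. -/
def eParity (i : Fin n) : Exponent n →+ ZMod 2 where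
  -- The element $e_i$ commutes with $x^\alpha$ but anticommutes with every $c_j$ and with the
  -- $e_j$, $j<i$.
  toFun p := ∑ j, p.2.1 j + ∑ j ∈ Finset.univ.filter (· < i), p.2.2 j
  map_zero' := by simp
  map_add' p q := by
    simp only [Prod.snd_add, Prod.fst_add, Pi.add_apply, Finset.sum_add_distrib]
    ring

@[simp] theorem cParity_xShift (i j : Fin n) : cParity n i (xShift n j) = if i = j then 1 else 0 := by
  simp [cParity, xShift, Pi.single_apply]

@[simp] theorem cParity_cShift (i j : Fin n) : cParity n i (cShift n j) = if j < i then 1 else 0 := by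
  simp [cParity, cShift, Pi.single_apply, Finset.sum_ite_eq']

@[simp] theorem cParity_eShift (i j : Fin n) : cParity n i (eShift n j) = 0 := by
  simp [cParity, eShift]

@[simp] theorem eParity_xShift (i j : Fin n) : eParity n i (xShift n j) = 0 := by
  simp [eParity, xShift]

@[simp] theorem eParity_cShift (i j : Fin n) : eParity n i (cShift n j) = 1 := by
  simp [eParity, cShift]

@[simp] theorem eParity_eShift (i j : Fin n) : eParity n i (eShift n j) = if j < i then 1 else 0 := by
  simp [eParity, eShift, Pi.single_apply]

theorem single_add_single_eq_zero (i : Fin n) :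
    (Pi.single i 1 + Pi.single i 1 : Fin n → ZMod 2) = 0 := by
  rw [← Pi.single_add]
  exact Pi.single_zero i

theorem model_rep : Rep ρ 0 (shiftOp ρ (xShift n) 0) 0 (shiftOp ρ (cShift n) (cParity n))
    (shiftOp ρ (eShift n) (eParity n)) translateOp where
  w_one := model_ext fun g p => by rw [translateOp_single, one_mul, Module.End.one_apply]
  w_mul g h := model_ext fun g' p => by
    rw [Module.End.mul_apply, translateOp_single, translateOp_single, translateOp_single, mul_assoc]
  c_sq i := shiftOp_sq ρ i (fun i => by simp [cShift, single_add_single_eq_zero])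
    (fun i => by simp)
  e_sq i := shiftOp_sq ρ i (fun i => by simp [eShift, single_add_single_eq_zero])
    (fun i => by simp)
  c_c i j h := by
    refine shiftOp_anticomm ρ fun σ => ?_
    rcases lt_or_gt_of_ne (σ.injective.ne h) with h | h <;> simp [h, h.not_gt]
  e_e i j h := by
    refine shiftOp_anticomm ρ fun σ => ?_
    rcases lt_or_gt_of_ne (σ.injective.ne h) with h | h <;> simp [h, h.not_gt]
  c_e i j := by
    refine shiftOp_anticomm ρ fun σ => ?_
    simp
  w_c g i := translateOp_shiftOp ρ _ _ g i
  w_e g i := translateOp_shiftOp ρ _ _ g i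
  w_x g i := translateOp_shiftOp ρ _ _ g i
  w_y g i := by simp
  e_x i j := by
    rw [shiftOp_comm ρ (s := fun _ _ => 1) (fun σ => rfl) fun σ => ?_, one_smul]
    simp
  c_x i j := by
    refine shiftOp_comm ρ (s := deltaSign) (fun σ => by simp [deltaSign]) fun σ => ?_
    by_cases h : i = j <;> simp [h, deltaSign]
  c_y i j := by simp
  e_y i j := by simp
  x_x i j := by
    rw [shiftOp_comm ρ (s := fun _ _ => 1) (fun σ => rfl) fun σ => ?_, one_smul]
    simp
  y_y i j := by simp
  y_x i j := by simp

theorem shiftOp_single_units (d : Fin n → Exponent n) (l : Fin n → Exponent n →+ ZMod 2)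
    (k : Fin n) (g : W) (p : Exponent n) : ∃ s : ℂˣ, shiftOp ρ d l k (Finsupp.single (g, p) 1) =
      s • Finsupp.single (g, p + d ((ρ g).right.symm k)) 1 := by
  obtain ⟨k, rfl⟩ := (ρ g).right.surjective k
  refine ⟨Units.mk0 _ (mul_ne_zero (sgn_ne_zero (ρ g) k) (paritySign_ne_zero (l k p))), ?_⟩
  rw [shiftOp_single, Equiv.symm_apply_apply]
  rfl

theorem orderedMonomial_shiftOp (d : Fin n → Exponent n) (l : Fin n → Exponent n →+ ZMod 2)
    (m : Fin n → ℕ) (g : W) (p : Exponent n) :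
    ∃ s : ℂˣ, orderedMonomial (shiftOp ρ d l) m (Finsupp.single (g, p) 1) =
      s • Finsupp.single (g, p + ∑ i, m i • d ((ρ g).right.symm i)) 1 :=
  orderedMonomial_apply (fun p => Finsupp.single (g, p) (1 : ℂ)) (shiftOp ρ d l)
    (fun i => d ((ρ g).right.symm i)) (fun i p => shiftOp_single_units ρ d l i g p) m p

/-- The monomial `x^α c^ε w e^{ε'}` in an algebra. -/
def posMonomial {B : Type} [Monoid B] (x c e : Fin n → B) (w : W → B)
    (q : (Fin n → ℕ) × (Fin n → ZMod 2) × W × (Fin n → ZMod 2)) : B :=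
  orderedMonomial x q.1 * orderedMonomial c (fun i => (q.2.1 i).val) * w q.2.2.1 *
    orderedMonomial e (fun i => (q.2.2.2 i).val)

theorem sum_smul_xShift (σ : Equiv.Perm (Fin n)) (m : Fin n → ℕ) :
    ∑ i, m i • xShift n (σ.symm i) = (fun i => m (σ i), 0, 0) := by
  rw [← Equiv.sum_comp σ]
  refine Prod.ext (funext fun i => ?_) (Prod.ext ?_ ?_) <;>
    simp [Prod.fst_sum, Prod.snd_sum, xShift, Finset.sum_apply, Pi.single_apply]

theorem sum_smul_cShift (σ : Equiv.Perm (Fin n)) (m : Fin n → ZMod 2) :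
    ∑ i, (m i).val • cShift n (σ.symm i) = (0, fun i => m (σ i), 0) := by
  rw [← Equiv.sum_comp σ]
  refine Prod.ext ?_ (Prod.ext (funext fun i => ?_) ?_) <;>
    simp [Prod.fst_sum, Prod.snd_sum, cShift, Finset.sum_apply, Pi.single_apply, -ZMod.natCast_val]
  exact ZMod.natCast_zmod_val _

theorem sum_smul_eShift (σ : Equiv.Perm (Fin n)) (m : Fin n → ZMod 2) :
    ∑ i, (m i).val • eShift n (σ.symm i) = (0, 0, fun i => m (σ i)) := by
  rw [← Equiv.sum_comp σ]
  refine Prod.ext ?_ (Prod.ext ?_ (funext fun i => ?_)) <;>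
    simp [Prod.fst_sum, Prod.snd_sum, eShift, Finset.sum_apply, Pi.single_apply, -ZMod.natCast_val]
  exact ZMod.natCast_zmod_val _

/-- Applied to the vector $(1,0)$, the factor $e^{\epsilon'}$ acts over the identity of $W$, while
$c^\epsilon$ and $x^\alpha$ act after the translation by $w$, so their exponents are pulled back
along $w$. For fixed $w$ this pullback is injective, so distinct monomials reach distinct basis
vectors. -/
theorem posMonomial_model_apply (q : (Fin n → ℕ) × (Fin n → ZMod 2) × W × (Fin n → ZMod 2)) :
    ∃ s : ℂˣ, posMonomial (shiftOp ρ (xShift n) 0) (shiftOp ρ (cShift n) (cParity n))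
      (shiftOp ρ (eShift n) (eParity n)) translateOp q (Finsupp.single (1, 0) 1) =
      s • Finsupp.single (q.2.2.1, (fun i => q.1 ((ρ q.2.2.1).right i),
        fun i => q.2.1 ((ρ q.2.2.1).right i), q.2.2.2)) 1 := by
  obtain ⟨α, ε, g, ε'⟩ := q
  obtain ⟨s, hs⟩ := orderedMonomial_shiftOp ρ (eShift n) (eParity n) (fun i => (ε' i).val) 1 0
  obtain ⟨s', hs'⟩ := orderedMonomial_shiftOp ρ (cShift n) (cParity n) (fun i => (ε i).val) g
    (0, 0, ε')
  obtain ⟨s'', hs''⟩ := orderedMonomial_shiftOp ρ (xShift n) 0 α g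
    (0, fun i => ε ((ρ g).right i), ε')
  rw [sum_smul_eShift] at hs
  rw [sum_smul_cShift] at hs'
  rw [sum_smul_xShift] at hs''
  simp only [map_one, SemidirectProduct.one_right, Equiv.Perm.one_apply, zero_add, Prod.mk_add_mk,
    add_zero] at hs hs' hs''
  refine ⟨s * s' * s'', ?_⟩
  simp only [posMonomial, Module.End.mul_apply, hs, Units.smul_def, map_smul, translateOp_single,
    mul_one, hs', hs'', smul_smul, Units.val_mul, mul_assoc]

theorem linearIndependent_posMonomial : LinearIndependent ℂ
    (posMonomial (fun i => posProj ρ (fx i)) (fun i => posProj ρ (fc i))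
      (fun i => posProj ρ (fe i)) (fun g => posProj ρ (fw g))) := by
  let F : PosAlg ρ →ₗ[ℂ] (W × Exponent n →₀ ℂ) :=
    (LinearMap.applyₗ (Finsupp.single (1, 0) (1 : ℂ))).comp (posLift (model_rep ρ)).toLinearMap
  refine LinearIndependent.of_comp F ?_
  choose s hs using posMonomial_model_apply ρ
  have hF : F ∘ posMonomial (fun i => posProj ρ (fx i)) (fun i => posProj ρ (fc i))
      (fun i => posProj ρ (fe i)) (fun g => posProj ρ (fw g)) =
      s • fun q => Finsupp.single (q.2.2.1, (fun i => q.1 ((ρ q.2.2.1).right i),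
        fun i => q.2.1 ((ρ q.2.2.1).right i), q.2.2.2)) (1 : ℂ) := by
    funext q
    rw [Pi.smul_apply', ← hs]
    simp [F, posMonomial, map_orderedMonomial, posLift_posProj]
  rw [hF]
  refine LinearIndependent.units_smul ?_ s
  refine (Finsupp.linearIndependent_single_one ℂ _).comp _ ?_
  rintro ⟨α, ε, g, ε'⟩ ⟨α₁, ε₁, g₁, ε'₁⟩ h
  simp only [Prod.mk.injEq] at h
  obtain ⟨rfl, h1, h2, rfl⟩ := h
  have h1' : α = α₁ := (ρ g).right.surjective.injective_comp_right h1
  have h2' : ε = ε₁ := (ρ g).right.surjective.injective_comp_right h2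
  rw [h1', h2']

end Model

/-! ### Spanning of the positive part by its monomials -/

section Span
variable {n : ℕ} {W : Type} [Group W] (ρ : W →* SignedPerm n)

/-- The product $X\,C\,G\,E$ of the four subspaces generated by the $x$, $c$, $w$ and $e$ contains
$1$ and is stable under left multiplication by every generator, hence is everything. -/
theorem span_posMonomial : Submodule.span ℂ (Set.range
    (posMonomial (fun i => posProj ρ (fx i)) (fun i => posProj ρ (fc i))
      (fun i => posProj ρ (fe i)) (fun g => posProj ρ (fw g)))) = ⊤ := by
  have h := posProj_rep ρ
  set x := fun i => posProj ρ (fx i) with hx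
  set c := fun i => posProj ρ (fc i) with hc
  set e := fun i => posProj ρ (fe i) with he
  set w := fun g => posProj ρ (fw g) with hw
  let X := Subalgebra.toSubmodule (Algebra.adjoin ℂ (Set.range x))
  let C := Subalgebra.toSubmodule (Algebra.adjoin ℂ (Set.range c))
  let E := Subalgebra.toSubmodule (Algebra.adjoin ℂ (Set.range e))
  let G := Submodule.span ℂ (Set.range w)
  have memx : ∀ i, x i ∈ Algebra.adjoin ℂ (Set.range x) := fun i => Algebra.subset_adjoin ⟨i, rfl⟩
  have memc : ∀ i, c i ∈ Algebra.adjoin ℂ (Set.range c) := fun i => Algebra.subset_adjoin ⟨i, rfl⟩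
  have meme : ∀ i, e i ∈ Algebra.adjoin ℂ (Set.range e) := fun i => Algebra.subset_adjoin ⟨i, rfl⟩
  have hle : X * (C * (G * E)) ≤ Submodule.span ℂ (Set.range (posMonomial x c e w)) := by
    calc X * (C * (G * E)) ≤ _ := mul_le_mul' (adjoin_le_span_orderedMonomial (S := ⊥)
          fun i j _ => sComm_of_comm (h.x_x i j)) (mul_le_mul'
            (adjoin_le_span_clifford h.c_sq h.c_c)
            (mul_le_mul' le_rfl (adjoin_le_span_clifford h.e_sq h.e_e)))
      _ ≤ _ := by
        rw [Submodule.span_mul_span, Submodule.span_mul_span, Submodule.span_mul_span]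
        refine Submodule.span_mono ?_
        rintro _ ⟨_, ⟨α, rfl⟩, _, ⟨_, ⟨ε, rfl⟩, _, ⟨_, ⟨g, rfl⟩, _, ⟨ε', rfl⟩, rfl⟩, rfl⟩, rfl⟩
        exact ⟨(α, ε, g, ε'), by simp only [posMonomial, mul_assoc]⟩
  have sgn_inv : ∀ (g : W) (z : Fin n → PosAlg ρ) (hz : ∀ i, w g * z i =
      sgn (ρ g) i • (z ((ρ g).right i) * w g)) (i : Fin n),
      ∃ z' ∈ Algebra.adjoin ℂ (Set.range z), w g * z i = z' * w g := fun g z hz i =>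
    ⟨sgn (ρ g) i • z ((ρ g).right i),
      Subalgebra.smul_mem _ (Algebra.subset_adjoin (Set.mem_range_self _)) _, by
      rw [hz, smul_mul_assoc]⟩
  have memG : ∀ g, ∀ t ∈ G, w g * t ∈ G := by
    intro g t ht
    induction ht using Submodule.span_induction with
    | mem t ht =>
      obtain ⟨g', rfl⟩ := ht
      rw [h.w_mul]
      exact Submodule.subset_span ⟨_, rfl⟩
    | zero => simp
    | add t t' _ _ ht ht' => rw [mul_add]; exact Submodule.add_mem _ ht ht'
    | smul r t _ ht => rw [mul_smul_comm]; exact Submodule.smul_mem _ _ ht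
  -- Crossing $w_g$ changes the index of $e_i$ in a way that depends on $g$, so
  -- `mul_mem_mul_of_pass` does not apply and the spanning elements $w_g$ are treated individually.
  have memGE : ∀ i, ∀ t ∈ G * E, e i * t ∈ G * E := by
    intro i t ht
    refine Submodule.mul_induction_on ht (fun t ht r hr => ?_) fun z z' hz hz' => ?_
    · induction ht using Submodule.span_induction with
      | mem t ht =>
        obtain ⟨g, rfl⟩ := ht
        obtain ⟨i, rfl⟩ := (ρ g).right.surjective i
        have h1 : e ((ρ g).right i) * w g = sgn (ρ g) i • (w g * e i) := by
          rw [h.w_e, smul_smul, sgn_mul_self, one_smul]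
        rw [← mul_assoc, h1, smul_mul_assoc, mul_assoc]
        exact Submodule.smul_mem _ _ (Submodule.mul_mem_mul (Submodule.subset_span ⟨_, rfl⟩)
          (Subalgebra.mul_mem (Algebra.adjoin ℂ (Set.range e)) (meme i) hr))
      | zero => simp
      | add t t' _ _ ht ht' => rw [add_mul, mul_add]; exact Submodule.add_mem _ ht ht'
      | smul r t _ ht =>
        rw [smul_mul_assoc, mul_smul_comm]
        exact Submodule.smul_mem _ _ ht
    · rw [mul_add]
      exact Submodule.add_mem _ hz hz'
  refine top_unique (le_trans ?_ hle)
  rintro z -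
  obtain ⟨a, rfl⟩ := posProj_surjective ρ z
  have key : ∀ t ∈ X * (C * (G * E)), posProj ρ a * t ∈ X * (C * (G * E)) := by
    refine free_stable ((Algebra.lmul ℂ (PosAlg ρ)).comp (posProj ρ)) _ (fun g t ht => ?_) a
    cases g with
    | x i => exact mul_mem_mul_of_left (g := x i) (fun t ht =>
      Subalgebra.mul_mem (Algebra.adjoin ℂ (Set.range x)) (memx i) ht) ht
    | y i =>
      change posProj ρ (fy i) * t ∈ _
      rw [posProj_fy, zero_mul]
      exact Submodule.zero_mem _
    | c i =>
      refine mul_mem_mul_of_pass (g := c i) (fun t ht => ?_) (fun r hr => ?_) ht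
      · exact exists_mul_eq_mul_of_adjoin (fun j => ⟨deltaSign i j • x j,
          Subalgebra.smul_mem _ (memx j) _, by rw [h.c_x, smul_mul_assoc]⟩) ht
      · exact mul_mem_mul_of_left (fun t ht =>
          Subalgebra.mul_mem (Algebra.adjoin ℂ (Set.range c)) (memc i) ht) hr
    | e i =>
      refine mul_mem_mul_of_pass (g := e i) (fun t ht => ?_) (fun r hr => ?_) ht
      · exact exists_mul_eq_mul_of_adjoin (fun j => ⟨x j, memx j, h.e_x i j⟩) ht
      · refine mul_mem_mul_of_pass (fun t ht => ?_) (memGE i) hr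
        exact exists_mul_eq_mul_of_adjoin (fun j => ⟨-c j, neg_mem (memc j), by
          rw [neg_mul, h.c_e, neg_neg]⟩) ht
    | w g =>
      refine mul_mem_mul_of_pass (g := w g) (fun t ht => ?_) (fun r hr => ?_) ht
      · exact exists_mul_eq_mul_of_adjoin (sgn_inv g x (h.w_x g)) ht
      · refine mul_mem_mul_of_pass (fun t ht => ?_) (fun r hr => ?_) hr
        · exact exists_mul_eq_mul_of_adjoin (sgn_inv g c (h.w_c g)) ht
        · exact mul_mem_mul_of_left (memG g) hr
  have h1 : (1 : PosAlg ρ) ∈ X * (C * (G * E)) := by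
    have : (1 : PosAlg ρ) = 1 * (1 * (w 1 * 1)) := by rw [h.w_one]; simp
    rw [this]
    exact Submodule.mul_mem_mul (Subalgebra.one_mem _) (Submodule.mul_mem_mul
      (Subalgebra.one_mem _) (Submodule.mul_mem_mul (Submodule.subset_span ⟨1, rfl⟩)
        (Subalgebra.one_mem _)))
  simpa using key 1 h1

end Span

/-! ### The monomial basis of the full algebra -/

section Basis
variable {n : ℕ} {W : Type} [Group W] {ρ : W →* SignedPerm n} {κ : Fin n → Fin n → Free n W}

theorem Rep.pos {B : Type} [Ring B] [Algebra ℂ B] {x y c e : Fin n → B} {w : W → B}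
    {k : Fin n → Fin n → B} (h : Rep ρ k x y c e w) : Rep ρ 0 x 0 c e w where
  w_one := h.w_one
  w_mul := h.w_mul
  c_sq := h.c_sq
  e_sq := h.e_sq
  c_c := h.c_c
  e_e := h.e_e
  c_e := h.c_e
  w_c := h.w_c
  w_e := h.w_e
  w_x := h.w_x
  w_y g i := by simp
  e_x := h.e_x
  c_x := h.c_x
  c_y i j := by simp
  e_y i j := by simp
  x_x := h.x_x
  y_y i j := by simp
  y_x i j := by simp

variable (ρ κ) in
theorem alg_rep : Rep ρ (fun i j => proj ρ κ (κ i j)) (x ρ κ) (y ρ κ) (c ρ κ) (e ρ κ) (w ρ κ) :=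
  Rep.of_map (proj ρ κ) fun _ _ hab => RingQuot.mkAlgHom_rel ℂ hab

variable (ρ κ) in
/-- The map from the positive part. -/
def posToAlg : PosAlg ρ →ₐ[ℂ] Alg ρ κ := posLift (alg_rep ρ κ).pos

theorem posToAlg_posProj (a : Free n W) : posToAlg ρ κ (posProj ρ a) =
    eval (x ρ κ) 0 (c ρ κ) (e ρ κ) (w ρ κ) a := posLift_posProj _ a

theorem posToAlg_posKappa (hκ : Consistent ρ κ) (i j : Fin n) :
    posToAlg ρ κ (posKappa ρ κ i j) = proj ρ κ (κ i j) := by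
  rw [posKappa, map_eval]
  simp only [posToAlg_posProj, eval_fx, eval_fc, eval_fe, eval_fw]
  rw [hκ.eval_congr _ _ (y ρ κ)]
  exact DFunLike.congr_fun (eval_comp (proj ρ κ)) (κ i j)

variable (ρ κ) in
/-- The linear map `p ⊗ y^γ ↦ p y^γ`. -/
def fromModule : PBWModule ρ →ₗ[ℂ] Alg ρ κ :=
  Finsupp.lsum ℂ fun γ => (LinearMap.mulRight ℂ (orderedMonomial (y ρ κ) γ)).comp
    (posToAlg ρ κ).toLinearMap

theorem fromModule_single (γ : Fin n → ℕ) (p : PosAlg ρ) :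
    fromModule ρ κ (Finsupp.single γ p) = posToAlg ρ κ p * orderedMonomial (y ρ κ) γ := by
  simp [fromModule]

theorem fromModule_smul (p : PosAlg ρ) (m : PBWModule ρ) :
    fromModule ρ κ (p • m) = posToAlg ρ κ p * fromModule ρ κ m := by
  induction m using Finsupp.induction_linear with
  | zero => simp
  | add m m' hm hm' => rw [smul_add, map_add, map_add, mul_add, hm, hm']
  | single γ q =>
    rw [Finsupp.smul_single, fromModule_single, fromModule_single, smul_eq_mul, map_mul, mul_assoc]

/-- The operators $y_i$ move past the generators of the positive part by the same rules as the
elements $y_i$ of the algebra, and the two sides agree on the $y^\gamma$. -/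
theorem fromModule_yAct (hκ : Consistent ρ κ) (m : PBWModule ρ) (i : Fin n) :
    fromModule ρ κ (yAct hκ i m) = y ρ κ i * fromModule ρ κ m := by
  have h := alg_rep ρ κ
  let T : Submodule ℂ (PBWModule ρ) := ⨅ i, LinearMap.eqLocus
    ((fromModule ρ κ).comp (yAct hκ i)) ((LinearMap.mulLeft ℂ (y ρ κ i)).comp (fromModule ρ κ))
  have mem_iff : ∀ m, m ∈ T ↔
      ∀ i, fromModule ρ κ (yAct hκ i m) = y ρ κ i * fromModule ρ κ m := by
    intro m
    simp only [T, Submodule.mem_iInf]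
    rfl
  refine (mem_iff m).1 (pbwModule_induction ρ T (fun γ => ?_) (fun l m hm => ?_)
    (fun l m hm => ?_) (fun l m hm => ?_) (fun g m hm => ?_) m) i <;> rw [mem_iff] at * <;> intro i
  · obtain ⟨s, hs, h1⟩ := mul_orderedMonomial (S := ⊥)
      (fun i j _ => sComm_of_comm (h.y_y i j)) i γ
    rw [Subgroup.mem_bot] at hs
    rw [yAct_single, fromModule_single, fromModule_single, map_one, one_mul, one_mul, h1, hs,
      one_smul]
  · rw [yAct_x, map_add, fromModule_smul, fromModule_smul, fromModule_smul, posToAlg_posKappa hκ,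
      hm, posToAlg_posProj, eval_fx, ← h.y_x, ← mul_assoc, ← mul_assoc, ← add_mul,
      add_sub_cancel]
  · rw [yAct_c, fromModule_smul, fromModule_smul, hm, posToAlg_posProj, eval_fc, ← mul_assoc,
      h.c_y, mul_assoc]
  · rw [yAct_e, map_smul, fromModule_smul, fromModule_smul, hm, posToAlg_posProj, eval_fe,
      ← mul_assoc, h.e_y, smul_mul_assoc, smul_smul, deltaSign_mul_self, one_smul, mul_assoc]
  · obtain ⟨i, rfl⟩ := (ρ g).right.surjective i
    rw [yAct_w, map_smul, fromModule_smul, fromModule_smul, hm, posToAlg_posProj, eval_fw,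
      ← mul_assoc, h.w_y, smul_mul_assoc, smul_smul, sgn_mul_self, one_smul, mul_assoc]

/-- For $m=y^0$ this exhibits every element of the algebra as an image of the module, which is how
spanning is obtained. -/
theorem fromModule_act (hκ : Consistent ρ κ) (a : Free n W) (m : PBWModule ρ) :
    fromModule ρ κ (act hκ (proj ρ κ a) m) = proj ρ κ a * fromModule ρ κ m := by
  induction a using FreeAlgebra.induction generalizing m with
  | grade0 r => simp [Algebra.algebraMap_eq_smul_one]
  | grade1 g =>
    cases g with
    | x i =>
      change fromModule ρ κ (act hκ (proj ρ κ (fx i)) m) = x ρ κ i * _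
      rw [act_proj, eval_fx, posAct_apply, fromModule_smul, posToAlg_posProj, eval_fx]
    | y i =>
      change fromModule ρ κ (act hκ (proj ρ κ (fy i)) m) = y ρ κ i * _
      rw [act_proj, eval_fy, fromModule_yAct]
    | c i =>
      change fromModule ρ κ (act hκ (proj ρ κ (fc i)) m) = c ρ κ i * _
      rw [act_proj, eval_fc, posAct_apply, fromModule_smul, posToAlg_posProj, eval_fc]
    | e i =>
      change fromModule ρ κ (act hκ (proj ρ κ (fe i)) m) = e ρ κ i * _
      rw [act_proj, eval_fe, posAct_apply, fromModule_smul, posToAlg_posProj, eval_fe]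
    | w g =>
      change fromModule ρ κ (act hκ (proj ρ κ (fw g)) m) = w ρ κ g * _
      rw [act_proj, eval_fw, posAct_apply, fromModule_smul, posToAlg_posProj, eval_fw]
  | mul a b ha hb => rw [map_mul, map_mul, Module.End.mul_apply, ha, hb, mul_assoc]
  | add a b ha hb => rw [map_add, map_add, LinearMap.add_apply, map_add, ha, hb, add_mul]

theorem posToAlg_posMonomial (q : (Fin n → ℕ) × (Fin n → ZMod 2) × W × (Fin n → ZMod 2)) :
    posToAlg ρ κ (posMonomial (fun i => posProj ρ (fx i)) (fun i => posProj ρ (fc i))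
      (fun i => posProj ρ (fe i)) (fun g => posProj ρ (fw g)) q) =
      posMonomial (x ρ κ) (c ρ κ) (e ρ κ) (w ρ κ) q := by
  simp [posMonomial, map_orderedMonomial, posToAlg_posProj]

theorem span_pbwMonomial (hκ : Consistent ρ κ) :
    Submodule.span ℂ (Set.range (pbwMonomial ρ κ)) = ⊤ := by
  refine top_unique ?_
  rintro z -
  obtain ⟨a, rfl⟩ : ∃ a, proj ρ κ a = z := RingQuot.mkAlgHom_surjective _ _ z
  have h1 : fromModule ρ κ (Finsupp.single 0 1) = 1 := by
    rw [fromModule_single, map_one, orderedMonomial_zero, one_mul]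
  have h2 : ∀ m, fromModule ρ κ m ∈ Submodule.span ℂ (Set.range (pbwMonomial ρ κ)) := by
    intro m
    induction m using Finsupp.induction_linear with
    | zero => simp
    | add m m' hm hm' => rw [map_add]; exact Submodule.add_mem _ hm hm'
    | single γ p =>
      have hp := (Submodule.eq_top_iff'.1 (span_posMonomial ρ)) p
      rw [fromModule_single]
      induction hp using Submodule.span_induction with
      | mem p hp =>
        obtain ⟨⟨α, ε, g, ε'⟩, rfl⟩ := hp
        rw [posToAlg_posMonomial]
        exact Submodule.subset_span ⟨(α, ε, g, ε', γ), rfl⟩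
      | zero => simp
      | add t t' _ _ ht ht' => rw [map_add, add_mul]; exact Submodule.add_mem _ ht ht'
      | smul r t _ ht => rw [map_smul, smul_mul_assoc]; exact Submodule.smul_mem _ _ ht
  have h3 := fromModule_act hκ a (Finsupp.single 0 1)
  rw [h1, mul_one] at h3
  rw [← h3]
  exact h2 _

/-- Acting on $y^0$, the monomial $x^\alpha c^\epsilon we^{\epsilon'}y^\gamma$ gives a unit multiple
of $x^\alpha c^\epsilon we^{\epsilon'}$ placed in the coordinate $\gamma$ of the free module;
independence is inherited from the positive part, coordinate by coordinate. -/
theorem linearIndependent_pbwMonomial (hκ : Consistent ρ κ) :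
    LinearIndependent ℂ (pbwMonomial ρ κ) := by
  let F : Alg ρ κ →ₗ[ℂ] PBWModule ρ :=
    (LinearMap.applyₗ (Finsupp.single 0 1)).comp (act hκ).toLinearMap
  refine LinearIndependent.of_comp F ?_
  have hy : ∀ γ : Fin n → ℕ, ∃ s : ℂˣ, orderedMonomial (yAct hκ) γ (Finsupp.single 0 1) =
      s • Finsupp.single γ (1 : PosAlg ρ) := by
    intro γ
    obtain ⟨s, hs⟩ := orderedMonomial_apply (fun γ => Finsupp.single γ (1 : PosAlg ρ)) (yAct hκ)
      (fun i => Pi.single i 1) (fun i p => ⟨1, by rw [yAct_single, one_smul]⟩) γ 0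
    refine ⟨s, hs.trans ?_⟩
    congr 2
    funext i
    simp [Finset.sum_apply, Pi.single_apply]
  choose s hs using hy
  have hF : F ∘ pbwMonomial ρ κ =
      (fun q : (Fin n → ℕ) × (Fin n → ZMod 2) × W × (Fin n → ZMod 2) × (Fin n → ℕ) =>
        s q.2.2.2.2) • fun q => Finsupp.single q.2.2.2.2
          (posMonomial (fun i => posProj ρ (fx i)) (fun i => posProj ρ (fc i))
            (fun i => posProj ρ (fe i)) (fun g => posProj ρ (fw g))
            (q.1, q.2.1, q.2.2.1, q.2.2.2.1)) := by
    funext q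
    obtain ⟨α, ε, g, ε', γ⟩ := q
    have h1 : pbwMonomial ρ κ (α, ε, g, ε', γ) =
        posMonomial (x ρ κ) (c ρ κ) (e ρ κ) (w ρ κ) (α, ε, g, ε') * orderedMonomial (y ρ κ) γ := rfl
    have hx : ∀ i, act hκ (x ρ κ i) = posAct ρ (posProj ρ (fx i)) := fun i => by
      rw [x, act_proj, eval_fx]
    have hc : ∀ i, act hκ (c ρ κ i) = posAct ρ (posProj ρ (fc i)) := fun i => by
      rw [c, act_proj, eval_fc]
    have he : ∀ i, act hκ (e ρ κ i) = posAct ρ (posProj ρ (fe i)) := fun i => by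
      rw [e, act_proj, eval_fe]
    have hw : ∀ g, act hκ (w ρ κ g) = posAct ρ (posProj ρ (fw g)) := fun g => by
      rw [w, act_proj, eval_fw]
    have hact : act hκ (posMonomial (x ρ κ) (c ρ κ) (e ρ κ) (w ρ κ) (α, ε, g, ε')) =
        posAct ρ (posMonomial (fun i => posProj ρ (fx i)) (fun i => posProj ρ (fc i))
          (fun i => posProj ρ (fe i)) (fun g => posProj ρ (fw g)) (α, ε, g, ε')) := by
      simp only [posMonomial, map_mul, map_orderedMonomial, hx, hc, he, hw]
    have hyact : ∀ i, act hκ (y ρ κ i) = yAct hκ i := fun i => by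
      rw [y, act_proj, eval_fy]
    change act hκ (pbwMonomial ρ κ (α, ε, g, ε', γ)) (Finsupp.single 0 1) = s γ • Finsupp.single γ _
    rw [h1, map_mul, hact, Module.End.mul_apply, map_orderedMonomial, funext hyact, hs,
      Units.smul_def, map_smul, posAct_apply, Finsupp.smul_single, smul_eq_mul, mul_one]
    rfl
  rw [hF]
  refine LinearIndependent.units_smul ?_ _
  have := (Finsupp.linearIndependent_single (ι := Fin n → ℕ) (fun _ => _)
    (fun _ => linearIndependent_posMonomial ρ)).comp
    (fun q : (Fin n → ℕ) × (Fin n → ZMod 2) × W × (Fin n → ZMod 2) × (Fin n → ℕ) =>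
      (⟨q.2.2.2.2, (q.1, q.2.1, q.2.2.1, q.2.2.2.1)⟩ : Σ _ : Fin n → ℕ,
        (Fin n → ℕ) × (Fin n → ZMod 2) × W × (Fin n → ZMod 2))) ?_
  · exact this
  · rintro ⟨α, ε, g, ε', γ⟩ ⟨α₁, ε₁, g₁, ε'₁, γ₁⟩ h
    simp only [Sigma.mk.injEq, heq_eq_eq, Prod.mk.injEq] at h
    simp [h]

theorem isPBWBasis (hκ : Consistent ρ κ) : IsPBWBasis ρ κ :=
  ⟨linearIndependent_pbwMonomial hκ, span_pbwMonomial hκ⟩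

end Basis

/-! ### Maps out of the polynomial and Clifford algebras, and bijectivity of multiplication -/

section Maps
variable {n : ℕ} {B : Type} [Ring B] [Algebra ℂ B]

theorem orderedMonomial_add {n : ℕ} {a : Fin n → B} (h : ∀ i j, a i * a j = a j * a i)
    (m m' : Fin n → ℕ) :
    orderedMonomial a (m + m') = orderedMonomial a m * orderedMonomial a m' := by
  induction n with
  | zero => simp [orderedMonomial]
  | succ n ih =>
    obtain ⟨s, hs, h1⟩ := ((SComm.orderedMonomial_right (S := ⊥) (fun i : Fin n =>
      sComm_of_comm (h 0 i.succ)) (fun i => m i.succ)).symm.pow_right (m' 0))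
    rw [Subgroup.mem_bot] at hs
    rw [hs, one_smul] at h1
    have h2 := ih (a := fun i => a i.succ) (fun i j => h i.succ j.succ) (fun i => m i.succ)
      (fun i => m' i.succ)
    rw [orderedMonomial_succ, orderedMonomial_succ, orderedMonomial_succ a m', mul_assoc,
      ← mul_assoc (orderedMonomial _ _) (a 0 ^ m' 0), h1, Pi.add_apply, pow_add, mul_assoc,
      mul_assoc (a 0 ^ m' 0), ← h2]
    rfl

theorem orderedMonomial_single {n : ℕ} {a : Fin n → B} (h : ∀ i j, a i * a j = a j * a i)
    (i : Fin n) : orderedMonomial a (Pi.single i 1) = a i := by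
  obtain ⟨s, hs, h1⟩ := mul_orderedMonomial (S := ⊥) (fun i j _ => sComm_of_comm (h i j)) i 0
  rw [Subgroup.mem_bot] at hs
  rw [orderedMonomial_zero, mul_one, zero_add, hs, one_smul] at h1
  exact h1.symm

/-- The evaluation of polynomials at pairwise commuting elements of an algebra. -/
def polyLift (a : Fin n → B) (h : ∀ i j, a i * a j = a j * a i) :
    MvPolynomial (Fin n) ℂ →ₐ[ℂ] B :=
  -- The target is noncommutative, so the map is obtained from the monoid homomorphism $m\mapsto
  -- a^m$.
  AddMonoidAlgebra.lift ℂ B (Fin n →₀ ℕ)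
    { toFun m := orderedMonomial a m.toAdd
      map_one' := orderedMonomial_zero a
      map_mul' m m' := by
        rw [toAdd_mul, Finsupp.coe_add, orderedMonomial_add h] }

theorem polyLift_monomial (a : Fin n → B) (h : ∀ i j, a i * a j = a j * a i) (m : Fin n →₀ ℕ) :
    polyLift a h (MvPolynomial.monomial m 1) = orderedMonomial a m :=
  (AddMonoidAlgebra.lift_single _ m (1 : ℂ)).trans (one_smul _ _)

theorem polyLift_X (a : Fin n → B) (h : ∀ i j, a i * a j = a j * a i) (i : Fin n) :
    polyLift a h (MvPolynomial.X i) = a i := by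
  rw [MvPolynomial.X, polyLift_monomial, Finsupp.single_eq_pi_single, orderedMonomial_single h]

theorem linearCombination_sq {a : Fin n → B} (ha : ∀ i, a i * a i = 1)
    (h : ∀ i j, i ≠ j → a i * a j = -(a j * a i)) (v : Fin n → ℂ) :
    Fintype.linearCombination ℂ a v * Fintype.linearCombination ℂ a v =
      algebraMap ℂ B (QuadraticMap.weightedSumSquares ℂ (fun _ : Fin n => (1 : ℂ)) v) := by
  have h1 : Fintype.linearCombination ℂ a v * Fintype.linearCombination ℂ a v =
      ∑ i, ∑ j, (v i * v j) • (a i * a j) := by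
    simp [Fintype.linearCombination_apply, Finset.sum_mul_sum, smul_smul, mul_comm]
  -- The double sum is added to its transpose, so that the off-diagonal terms cancel by
  -- anticommutation; the factor $2$ is removed afterwards.
  have h2 : (2 : ℂ) • ∑ i, ∑ j, (v i * v j) • (a i * a j) =
      (2 : ℂ) • ∑ i, (v i * v i) • (1 : B) := by
    rw [two_smul]
    conv_lhs => arg 2; rw [Finset.sum_comm]
    rw [← Finset.sum_add_distrib, Finset.smul_sum]
    refine Finset.sum_congr rfl fun i _ => ?_
    rw [← Finset.sum_add_distrib, Finset.sum_eq_single i, ha, two_smul]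
    · intro j _ hj
      rw [h i j hj.symm, mul_comm (v j), smul_neg, neg_add_cancel]
    · simp
  rw [h1, smul_right_injective B (two_ne_zero (α := ℂ)) h2, Algebra.algebraMap_eq_smul_one,
    QuadraticMap.weightedSumSquares_apply, Finset.sum_smul]
  simp

/-- The map from the Clifford algebra given by anticommuting square roots of `1`. -/
def cliffLift (a : Fin n → B) (ha : ∀ i, a i * a i = 1)
    (h : ∀ i j, i ≠ j → a i * a j = -(a j * a i)) : Cliff n →ₐ[ℂ] B :=
  CliffordAlgebra.lift _ ⟨Fintype.linearCombination ℂ a, linearCombination_sq ha h⟩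

theorem cliffLift_gen (a : Fin n → B) (ha : ∀ i, a i * a i = 1)
    (h : ∀ i j, i ≠ j → a i * a j = -(a j * a i)) (i : Fin n) :
    cliffLift a ha h (Cliff.gen i) = a i := by
  rw [cliffLift, Cliff.gen, CliffordAlgebra.lift_ι_apply, Fintype.linearCombination_apply_single,
    one_smul]

theorem Cliff.gen_sq (i : Fin n) : Cliff.gen i * Cliff.gen i = 1 := by
  rw [Cliff.gen, CliffordAlgebra.ι_sq_scalar, QuadraticMap.weightedSumSquares_apply]
  simp [Pi.single_apply]

theorem Cliff.gen_anticomm (i j : Fin n) (hij : i ≠ j) :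
    Cliff.gen i * Cliff.gen j = -(Cliff.gen j * Cliff.gen i) := by
  refine eq_neg_of_add_eq_zero_left (CliffordAlgebra.ι_mul_ι_add_swap_of_isOrtho ?_)
  rw [QuadraticMap.isOrtho_def]
  simp only [QuadraticMap.weightedSumSquares_apply, ← Finset.sum_add_distrib]
  refine Finset.sum_congr rfl fun k _ => ?_
  rcases eq_or_ne k i with rfl | hki
  · simp [hij]
  · simp [Pi.single_apply, hki]

theorem Cliff.span_orderedMonomial : Submodule.span ℂ (Set.range fun ε : Fin n → ZMod 2 =>
    orderedMonomial Cliff.gen fun i => (ε i).val) = ⊤ := by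
  refine top_unique (le_trans ?_ (adjoin_le_span_clifford Cliff.gen_sq Cliff.gen_anticomm))
  have : Algebra.adjoin ℂ (Set.range (Cliff.gen : Fin n → Cliff n)) = ⊤ := by
    rw [← top_le_iff, ← CliffordAlgebra.adjoin_range_ι]
    refine Algebra.adjoin_le ?_
    rintro _ ⟨v, rfl⟩
    rw [LinearMap.pi_apply_eq_sum_univ]
    refine Subalgebra.sum_mem _ fun i _ => Subalgebra.smul_mem _
      (Algebra.subset_adjoin (Set.mem_range.2 ⟨i, ?_⟩)) _
    rw [Cliff.gen]
    congr 1
    funext j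
    simp [Pi.single_apply, eq_comm]
  rw [this]
  rfl

theorem span_range_of {G : Type} [Monoid G] :
    Submodule.span ℂ (Set.range (MonoidAlgebra.of ℂ G)) = ⊤ := by
  refine top_unique ?_
  rintro z -
  induction z using MonoidAlgebra.induction_on with
  | of g => exact Submodule.subset_span ⟨g, rfl⟩
  | add z z' hz hz' => exact Submodule.add_mem _ hz hz'
  | smul r z hz => exact Submodule.smul_mem _ r hz

theorem span_range_monomial : Submodule.span ℂ (Set.range fun α : Fin n → ℕ =>
    (MvPolynomial.monomial (Finsupp.equivFunOnFinite.symm α) 1 : MvPolynomial (Fin n) ℂ)) = ⊤ := by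
  rw [← (MvPolynomial.basisMonomials (Fin n) ℂ).span_eq, MvPolynomial.coe_basisMonomials]
  exact congrArg _ (Finsupp.equivFunOnFinite.symm.surjective.range_comp
    fun s => (MvPolynomial.monomial s 1 : MvPolynomial (Fin n) ℂ))

theorem span_range_tmul {V V' ι ι' : Type} [AddCommMonoid V] [Module ℂ V] [AddCommMonoid V']
    [Module ℂ V'] {v : ι → V} {v' : ι' → V'} (hv : Submodule.span ℂ (Set.range v) = ⊤)
    (hv' : Submodule.span ℂ (Set.range v') = ⊤) :
    Submodule.span ℂ (Set.range fun p : ι × ι' => v p.1 ⊗ₜ[ℂ] v' p.2) = ⊤ := by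
  rw [← TensorProduct.map₂_mk_top_top_eq_top, ← hv, ← hv', Submodule.map₂_span_span,
    Set.image2_range]
  rfl

theorem injective_of_linearIndependent_family {V ι ι' : Type} [AddCommGroup V] [Module ℂ V]
    {v : ι → V} {f : ι' → B} (F : V →ₗ[ℂ] B) (hv : Submodule.span ℂ (Set.range v) = ⊤)
    (hf : LinearIndependent ℂ f) (τ : ι → ι') (hτ : Function.Injective τ)
    (h : ∀ i, F (v i) = f (τ i)) : Function.Injective F := by
  refine LinearMap.injective_of_linearIndependent hv ?_
  rw [show ⇑F ∘ v = f ∘ τ from funext h]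
  exact hf.comp τ hτ

/-- The tensor product has $y$ before $e$, whereas the basis $f$ has $e$ before $y$. The scalars $s$
and the reindexing account for this; unit multiples of a basis still form a basis. -/
theorem mulMap_bijective {A₁ A₂ A₃ A₄ A₅ ι₁ ι₂ ι₃ ι₄ ι₅ : Type} [Ring A₁] [Ring A₂] [Ring A₃]
    [Ring A₄] [Ring A₅] [Algebra ℂ A₁] [Algebra ℂ A₂] [Algebra ℂ A₃] [Algebra ℂ A₄] [Algebra ℂ A₅]
    (φ₁ : A₁ →ₐ[ℂ] B) (φ₂ : A₂ →ₐ[ℂ] B) (φ₃ : A₃ →ₐ[ℂ] B) (φ₄ : A₄ →ₐ[ℂ] B) (φ₅ : A₅ →ₐ[ℂ] B)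
    {v₁ : ι₁ → A₁} {v₂ : ι₂ → A₂} {v₃ : ι₃ → A₃} {v₄ : ι₄ → A₄} {v₅ : ι₅ → A₅}
    (h₁ : Submodule.span ℂ (Set.range v₁) = ⊤) (h₂ : Submodule.span ℂ (Set.range v₂) = ⊤)
    (h₃ : Submodule.span ℂ (Set.range v₃) = ⊤) (h₄ : Submodule.span ℂ (Set.range v₄) = ⊤)
    (h₅ : Submodule.span ℂ (Set.range v₅) = ⊤) {f : ι₁ × ι₂ × ι₃ × ι₅ × ι₄ → B}
    (hli : LinearIndependent ℂ f) (hspan : Submodule.span ℂ (Set.range f) = ⊤)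
    (s : ι₄ → ι₅ → ℂˣ)
    (hs : ∀ i₁ i₂ i₃ i₄ i₅, φ₁ (v₁ i₁) * (φ₂ (v₂ i₂) * (φ₃ (v₃ i₃) * (φ₄ (v₄ i₄) * φ₅ (v₅ i₅)))) =
      s i₄ i₅ • f (i₁, i₂, i₃, i₅, i₄)) :
    Function.Bijective (mulMap φ₁ φ₂ φ₃ φ₄ φ₅) := by
  let g : ι₁ × ι₂ × ι₃ × ι₄ × ι₅ → B := fun p => f (p.1, p.2.1, p.2.2.1, p.2.2.2.2, p.2.2.2.1)
  let z : ι₁ × ι₂ × ι₃ × ι₄ × ι₅ → ℂˣ := fun p => s p.2.2.2.1 p.2.2.2.2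
  have hfv : ⇑(mulMap φ₁ φ₂ φ₃ φ₄ φ₅) ∘ (fun p : ι₁ × ι₂ × ι₃ × ι₄ × ι₅ => v₁ p.1 ⊗ₜ[ℂ]
      (v₂ p.2.1 ⊗ₜ[ℂ] (v₃ p.2.2.1 ⊗ₜ[ℂ] (v₄ p.2.2.2.1 ⊗ₜ[ℂ] v₅ p.2.2.2.2)))) = z • g :=
    funext fun p => hs p.1 p.2.1 p.2.2.1 p.2.2.2.1 p.2.2.2.2
  refine LinearMap.bijective_of_linearIndependent_of_span_eq_top (span_range_tmul h₁
    (span_range_tmul h₂ (span_range_tmul h₃ (span_range_tmul h₄ h₅)))) ?_ ?_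
  · rw [hfv]
    refine LinearIndependent.units_smul (hli.comp (fun p : ι₁ × ι₂ × ι₃ × ι₄ × ι₅ =>
      (p.1, p.2.1, p.2.2.1, p.2.2.2.2, p.2.2.2.1)) ?_) z
    rintro ⟨i₁, i₂, i₃, i₄, i₅⟩ ⟨j₁, j₂, j₃, j₄, j₅⟩ hp
    simp only [Prod.mk.injEq] at hp
    simp [hp]
  · rw [hfv, eq_top_iff, ← hspan, Submodule.span_le]
    rintro _ ⟨⟨i₁, i₂, i₃, i₅, i₄⟩, rfl⟩
    have hmem := Submodule.smul_mem _ (↑(s i₄ i₅)⁻¹ : ℂ) (Submodule.subset_span (R := ℂ)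
      (Set.mem_range_self (f := z • g) (i₁, i₂, i₃, i₄, i₅)))
    rwa [Pi.smul_apply', ← Units.smul_def, inv_smul_smul] at hmem

end Maps

/-! ### From the basis to the tensor product decomposition -/

section Iso
variable {n : ℕ} {W : Type} [Group W] {ρ : W →* SignedPerm n} {κ : Fin n → Fin n → Free n W}

theorem orderedMonomial_fun_zero {A : Type} [Monoid A] (a : Fin n → A) :
    (orderedMonomial a fun _ => 0) = 1 :=
  orderedMonomial_zero a

theorem sComm_of_deltaSign {B : Type} [Ring B] [Algebra ℂ B] {a b : B} {i j : Fin n}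
    (h : a * b = deltaSign i j • (b * a)) : SComm ⊤ a b := by
  rcases deltaSign_eq_one_or i j with hd | hd
  · exact sComm_of_comm (by rw [h, hd, one_smul])
  · exact sComm_of_anticomm (by rw [h, hd, neg_one_smul])

/-- If the ordered monomials form a basis, multiplication gives a linear isomorphism. -/
theorem Rep.exists_bijective_mulMap {B : Type} [Ring B] [Algebra ℂ B] {x y c e : Fin n → B}
    {w : W → B} {k : Fin n → Fin n → B} (h : Rep ρ k x y c e w)
    {f : (Fin n → ℕ) × (Fin n → ZMod 2) × W × (Fin n → ZMod 2) × (Fin n → ℕ) → B}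
    (hf : ∀ p, f p = orderedMonomial x p.1 * orderedMonomial c (fun i => (p.2.1 i).val) *
      w p.2.2.1 * orderedMonomial e (fun i => (p.2.2.2.1 i).val) * orderedMonomial y p.2.2.2.2)
    (hli : LinearIndependent ℂ f) (hspan : Submodule.span ℂ (Set.range f) = ⊤) :
    ∃ (φx : MvPolynomial (Fin n) ℂ →ₐ[ℂ] B) (φc : Cliff n →ₐ[ℂ] B)
      (φw : MonoidAlgebra ℂ W →ₐ[ℂ] B)
      (φy : MvPolynomial (Fin n) ℂ →ₐ[ℂ] B) (φe : Cliff n →ₐ[ℂ] B),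
      (∀ i, φx (MvPolynomial.X i) = x i) ∧ (∀ i, φc (Cliff.gen i) = c i) ∧
      (∀ g, φw (MonoidAlgebra.of ℂ W g) = w g) ∧
      (∀ i, φy (MvPolynomial.X i) = y i) ∧ (∀ i, φe (Cliff.gen i) = e i) ∧
      Function.Injective φx ∧ Function.Injective φc ∧ Function.Injective φw ∧
      Function.Injective φy ∧ Function.Injective φe ∧
      Function.Bijective (mulMap φx φc φw φy φe) := by
  let φw : MonoidAlgebra ℂ W →ₐ[ℂ] B := MonoidAlgebra.lift ℂ B W
    { toFun := w
      map_one' := h.w_one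
      map_mul' := fun g g' => (h.w_mul g g').symm }
  have φw_of : ∀ g, φw (MonoidAlgebra.of ℂ W g) = w g := fun g => MonoidAlgebra.lift_of _ g
  have φx_mon : ∀ α : Fin n → ℕ, polyLift _ h.x_x
      (MvPolynomial.monomial (Finsupp.equivFunOnFinite.symm α) 1) = orderedMonomial x α :=
    fun α => polyLift_monomial _ _ _
  have φy_mon : ∀ γ : Fin n → ℕ, polyLift _ h.y_y
      (MvPolynomial.monomial (Finsupp.equivFunOnFinite.symm γ) 1) = orderedMonomial y γ :=
    fun γ => polyLift_monomial _ _ _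
  have φc_mon : ∀ m : Fin n → ℕ, cliffLift _ h.c_sq h.c_c (orderedMonomial Cliff.gen m) =
      orderedMonomial c m := fun m => by
    rw [map_orderedMonomial]
    simp only [cliffLift_gen]
  have φe_mon : ∀ m : Fin n → ℕ, cliffLift _ h.e_sq h.e_e (orderedMonomial Cliff.gen m) =
      orderedMonomial e m := fun m => by
    rw [map_orderedMonomial]
    simp only [cliffLift_gen]
  refine ⟨polyLift _ h.x_x, cliffLift _ h.c_sq h.c_c, φw, polyLift _ h.y_y,
    cliffLift _ h.e_sq h.e_e, polyLift_X _ _, cliffLift_gen _ _ _, φw_of, polyLift_X _ _,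
    cliffLift_gen _ _ _, ?_, ?_, ?_, ?_, ?_, ?_⟩
  · exact injective_of_linearIndependent_family (polyLift _ h.x_x).toLinearMap span_range_monomial hli
      (fun α => (α, 0, 1, 0, 0)) (fun α α' hα => congrArg Prod.fst hα) fun α => by
        simp [hf, φx_mon, orderedMonomial_fun_zero, orderedMonomial_zero, h.w_one]
  · exact injective_of_linearIndependent_family (cliffLift _ h.c_sq h.c_c).toLinearMap
      Cliff.span_orderedMonomial hli (fun ε => (0, ε, 1, 0, 0)) (fun α α' hα => congrArg (·.2.1) hα)
      fun ε => by simp [hf, φc_mon, orderedMonomial_fun_zero, orderedMonomial_zero, h.w_one]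
  · exact injective_of_linearIndependent_family φw.toLinearMap span_range_of hli
      (fun g => (0, 0, g, 0, 0)) (fun α α' hα => congrArg (·.2.2.1) hα) fun g =>
        (φw_of g).trans (by simp [hf, orderedMonomial_fun_zero, orderedMonomial_zero])
  · exact injective_of_linearIndependent_family (polyLift _ h.y_y).toLinearMap span_range_monomial hli
      (fun γ => (0, 0, 1, 0, γ)) (fun α α' hα => congrArg (·.2.2.2.2) hα) fun γ => by
        simp [hf, φy_mon, orderedMonomial_fun_zero, orderedMonomial_zero, h.w_one]
  · exact injective_of_linearIndependent_family (cliffLift _ h.e_sq h.e_e).toLinearMap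
      Cliff.span_orderedMonomial hli (fun ε => (0, 0, 1, ε, 0))
      (fun α α' hα => congrArg (·.2.2.2.1) hα)
      fun ε => by simp [hf, φe_mon, orderedMonomial_fun_zero, orderedMonomial_zero, h.w_one]
  -- Each $e_i$ commutes with each $y_j$ up to sign, hence so do the monomials up to a scalar; this
  -- supplies the units relating the two orders.
  · have hcomm : ∀ (γ : Fin n → ℕ) (ε : Fin n → ZMod 2),
        SComm ⊤ (orderedMonomial y γ) (orderedMonomial e fun i => (ε i).val) := by
      intro γ ε
      refine SComm.orderedMonomial_right (fun i => SComm.symm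
        (SComm.orderedMonomial_right (fun j => ?_) γ)) _
      exact sComm_of_deltaSign (h.e_y i j)
    choose s _ hs using hcomm
    refine mulMap_bijective _ _ _ _ _ span_range_monomial Cliff.span_orderedMonomial span_range_of
      span_range_monomial Cliff.span_orderedMonomial hli hspan s fun α ε g γ ε' => ?_
    rw [φx_mon, φc_mon, φw_of, φy_mon, φe_mon, hs, hf]
    simp only [mul_smul_comm, mul_assoc]

theorem isPBWIso_of_isPBWBasis (hb : IsPBWBasis ρ κ) : IsPBWIso ρ κ :=
  (alg_rep ρ κ).exists_bijective_mulMap (f := pbwMonomial ρ κ) (fun _ => rfl) hb.1 hb.2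

end Iso

end Daha

end

theorem mainTheorem1 (n : ℕ) (t u v : ℂ) :
    (Daha.IsPBWIso (Daha.inclA n) (Daha.kappaA n t u) ∧
      Daha.IsPBWBasis (Daha.inclA n) (Daha.kappaA n t u)) ∧
    (Daha.IsPBWIso (Daha.evenSignedPerm n).subtype (Daha.kappaD n t u) ∧
      Daha.IsPBWBasis (Daha.evenSignedPerm n).subtype (Daha.kappaD n t u)) ∧
    (Daha.IsPBWIso (MonoidHom.id (Daha.SignedPerm n)) (Daha.kappaB n t u v) ∧
      Daha.IsPBWBasis (MonoidHom.id (Daha.SignedPerm n)) (Daha.kappaB n t u v)) := by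
  have hA := Daha.isPBWBasis (Daha.consistent_kappaA (n := n) t u)
  have hD := Daha.isPBWBasis (Daha.consistent_kappaD (n := n) t u)
  have hB := Daha.isPBWBasis (Daha.consistent_kappaB (n := n) t u v)
  exact ⟨⟨Daha.isPBWIso_of_isPBWBasis hA, hA⟩, ⟨Daha.isPBWIso_of_isPBWBasis hD, hD⟩,
    ⟨Daha.isPBWIso_of_isPBWBasis hB, hB⟩⟩
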